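/- Let $\mathfrak o$ be a Dedekind domain which is not a field, $K$ its fraction field, $L/K$ a (possibly infinite) Galois extension with group $G=\mathrm{Gal}(L/K)$, and $\mathfrak O$ the integral closure of $\mathfrak o$ in $L$. Let $\mathcal F(\mathfrak O)$ be the commutative monoid of non-zero fractional ideals of $\mathfrak O$ in $L$ under multiplication, $\mathcal I(\mathfrak O)$ the group of invertible ones, and $\mathcal P(\mathfrak O)$ the group of principal ones. Put $\mathrm{Cl}(\mathfrak O)=\mathcal F(\mathfrak O)/\mathcal P(\mathfrak O)$ and $\mathrm{Pic}(\mathfrak O)=\mathcal I(\mathfrak O)/\mathcal P(\mathfrak O)$, and let $\mathrm{Reg}\,\mathrm{Cl}(\mathfrak O)=\{a\in \mathrm{Cl}(\mathfrak O) : \exists\, b\in\mathrm{Cl}(\mathfrak O),\ a=aba\}$. For a maximal ideal $\mathfrak P$ of $\mathfrak O$ let $v_{\mathfrak P}\colon L^\times\to\mathbb Q$ be the additive valuation with valuation ring $\mathfrak O_{\mathfrak P}$ normalized by $v_{\mathfrak P}(K^\times)=\mathbb Z$. For every maximal ideal $\mathfrak p$ of $\mathfrak o$ fix a maximal ideal $\mathfrak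 p_L$ of $\mathfrak O$ above $\mathfrak p$; let $D_{\mathfrak p}=\{\sigma\in G:\sigma(\mathfrak p_L)=\mathfrak p_L\}$ and $v_{\mathfrak p}=v_{\mathfrak p_L}$. Let $\mathrm R^\infty_{L/K}(\mathfrak o)$ be the set of all maximal ideals $\mathfrak p$ of $\mathfrak o$ such that $v_{\mathfrak p}(L^\times)$ is different from its closure in $\mathbb R$ (equivalently, is not discrete). Suppose that every non-zero element of $\mathfrak O$ is contained in at most finitely many maximal ideals of $\mathfrak O$. Then there is a $G$-equivariant isomorphism of commutative monoids $$\mathrm{Reg}\,\mathrm{Cl}(\mathfrak O)/\mathrm{Pic}(\mathfrak O)\;\simeq\;\bigoplus_{\mathfrak p\in \mathrm R^\infty_{L/K}(\mathfrak o)}\ \bigoplus_{\tau D_{\mathfrak p}\in G/D_{\mathfrak p}}\Bigl(\{0\}\sqcup \mathbb R/v_{\mathfrak p}(L^\times)\Bigr).$$ Here $\{0\}\sqcup A$, for an abelian group $A$, is the commutative monoid obtained from $A$ by adjoining a new neutral element $0$; $G$ acts on the left-hand side by $I\mapsto\sigma(I)$, and on the right-hand side by $(\sigma x)_{\mathfrak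 p,\,\tau D_{\mathfrak p}}=x_{\mathfrak p,\,\sigma^{-1}\tau D_{\mathfrak p}}$. -/

import Mathlib

set_option linter.unusedSectionVars false

open scoped nonZeroDivisors DirectSum

/-! ### Quotients and regular parts of commutative monoids -/

section Monoids

variable {M M' : Type*} [CommMonoid M] [CommMonoid M']

/-- The congruence on a commutative monoid `M` defining the quotient `M / N` by a submonoid `N`.
If `N` is a group, then `a ∼ b` just says that `a` and `b` lie in the same `N`-orbit. -/
def quotCon (N : Submonoid M) : Con M where
  r a b := ∃ m ∈ N, ∃ n ∈ N, m * a = n * b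
  iseqv :=
    { refl := fun a => ⟨1, N.one_mem, 1, N.one_mem, rfl⟩
      symm := fun ⟨m, hm, n, hn, h⟩ => ⟨n, hn, m, hm, h.symm⟩
      trans := by
        rintro a b c ⟨m, hm, n, hn, h⟩ ⟨m', hm', n', hn', h'⟩
        refine ⟨m' * m, N.mul_mem hm' hm, n * n', N.mul_mem hn hn', ?_⟩
        rw [mul_assoc, h, mul_left_comm, h', mul_assoc] }
  mul' := by
    rintro a b c d ⟨m, hm, n, hn, h⟩ ⟨m', hm', n', hn', h'⟩
    refine ⟨m * m', N.mul_mem hm hm', n * n', N.mul_mem hn hn', ?_⟩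
    rw [mul_mul_mul_comm, h, h', mul_mul_mul_comm]

/-- The quotient monoid `M / N`. -/
abbrev MonQuot (N : Submonoid M) : Type _ := (quotCon N).Quotient

/-- The homomorphism `M / N →* M' / N'` induced by a homomorphism `f` with `f(N) ⊆ N'`. -/
def MonQuot.map {N : Submonoid M} {N' : Submonoid M'} (f : M →* M') (h : ∀ n ∈ N, f n ∈ N') :
    MonQuot N →* MonQuot N' :=
  (quotCon N).lift ((quotCon N').mk'.comp f) (by
    rintro a b ⟨m, hm, n, hn, e⟩
    exact (Con.eq _).2 ⟨f m, h m hm, f n, h n hn, by rw [← map_mul, e, map_mul]⟩)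

variable (M) in
/-- The submonoid `Reg M` of von Neumann regular elements of a commutative monoid `M`. -/
def Reg : Submonoid M where
  carrier := {a | ∃ b, a = a * b * a}
  one_mem' := ⟨1, by simp⟩
  mul_mem' := by
    rintro a c ⟨b, hb⟩ ⟨d, hd⟩
    refine ⟨b * d, ?_⟩
    calc a * c = (a * b * a) * (c * d * c) := by rw [← hb, ← hd]
      _ = a * c * (b * d) * (a * c) := by ac_rfl

/-- The homomorphism `Reg M →* Reg M'` induced by a homomorphism `M →* M'`. -/
def Reg.map (f : M →* M') : Reg M →* Reg M' :=
  (f.comp (Reg M).subtype).codRestrict (Reg M') (by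
    rintro ⟨a, b, hb⟩
    exact ⟨f b, by simpa using congrArg f hb⟩)

end Monoids

/-! ### Fractional ideals and the ideal class semigroup -/

section Ideals

variable (R L : Type*) [CommRing R] [Field L] [Algebra R L]

/-- The monoid `𝓕(R)` of non-zero fractional ideals of `R` (inside the field `L`). -/
def FracMon : Submonoid (FractionalIdeal R⁰ L) where
  carrier := {I | I ≠ 0}
  one_mem' := one_ne_zero
  mul_mem' := by
    intro I J hI hJ h
    have hI' : ∃ x ∈ I, x ≠ 0 := by
      by_contra! hc
      exact hI (FractionalIdeal.eq_zero_iff.2 hc)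
    have hJ' : ∃ x ∈ J, x ≠ 0 := by
      by_contra! hc
      exact hJ (FractionalIdeal.eq_zero_iff.2 hc)
    obtain ⟨x, hx, hx0⟩ := hI'
    obtain ⟨y, hy, hy0⟩ := hJ'
    exact mul_ne_zero hx0 hy0
      (FractionalIdeal.eq_zero_iff.1 h _ (FractionalIdeal.mul_mem_mul hx hy))

/-- The group `𝓘(R)` of invertible fractional ideals, as a submonoid of `𝓕(R)`. -/
def InvMon : Submonoid (FracMon R L) := IsUnit.submonoid (FracMon R L)

/-- The group `𝓟(R)` of principal fractional ideals `aR`, `a ∈ Lˣ`, as a submonoid of `𝓕(R)`. -/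
def PrincMon : Submonoid (FracMon R L) where
  carrier := {I | ∃ a : L, a ≠ 0 ∧
    ∀ x : L, x ∈ (I : FractionalIdeal R⁰ L) ↔ ∃ r : R, algebraMap R L r * a = x}
  one_mem' := ⟨1, one_ne_zero, fun x => by
    change x ∈ (1 : FractionalIdeal R⁰ L) ↔ _
    simp [FractionalIdeal.mem_one_iff]⟩
  mul_mem' := by
    rintro I J ⟨a, ha, hI⟩ ⟨b, hb, hJ⟩
    refine ⟨a * b, mul_ne_zero ha hb, fun x => ⟨fun hx => ?_, ?_⟩⟩
    · refine FractionalIdeal.mul_induction_on hx (fun y hy z hz => ?_) (fun y z hy hz => ?_)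
      · obtain ⟨r, rfl⟩ := (hI y).1 hy
        obtain ⟨t, rfl⟩ := (hJ z).1 hz
        exact ⟨r * t, by rw [map_mul]; ring⟩
      · obtain ⟨r, rfl⟩ := hy
        obtain ⟨t, rfl⟩ := hz
        exact ⟨r + t, by rw [map_add]; ring⟩
    · rintro ⟨r, rfl⟩
      rw [← mul_assoc]
      exact FractionalIdeal.mul_mem_mul ((hI _).2 ⟨r, rfl⟩) ((hJ _).2 ⟨1, by simp⟩)

/-- The ideal class semigroup `Cl(R) = 𝓕(R) / 𝓟(R)`. -/
abbrev IdealCl : Type _ := MonQuot (PrincMon R L)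

/-- The Picard group `Pic(R) = 𝓘(R) / 𝓟(R)`, as a submonoid of `Cl(R)`. -/
def PicMon : Submonoid (IdealCl R L) := (InvMon R L).map (quotCon (PrincMon R L)).mk'

theorem PicMon_le_Reg : PicMon R L ≤ Reg (IdealCl R L) := by
  rintro _ ⟨I, ⟨u, rfl⟩, rfl⟩
  exact ⟨(quotCon (PrincMon R L)).mk' (↑u⁻¹ : FracMon R L), by
    rw [← map_mul, ← map_mul]; simp⟩

/-- The quotient monoid `Reg Cl(R) / Pic(R)`. -/
abbrev RegClModPic : Type _ :=
  MonQuot ((PicMon R L).comap (Reg (IdealCl R L)).subtype)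

end Ideals

/-! ### The action of automorphisms on fractional ideals -/

section Action

variable {R L : Type*} [CommRing R] [IsDomain R] [Field L] [Algebra R L]

/-- The fractional ideal `s(I) = {s(x) | x ∈ I}`, for an automorphism `s` of the field `L`
that restricts to an automorphism `g` of the ring `R`. -/
def FractionalIdeal.image (s : L ≃+* L) (g : R ≃+* R)
    (hs : ∀ r, s (algebraMap R L r) = algebraMap R L (g r)) (I : FractionalIdeal R⁰ L) :
    FractionalIdeal R⁰ L :=
  ⟨{ carrier := s '' (I : Set L)
     add_mem' := by
       rintro _ _ ⟨x, hx, rfl⟩ ⟨y, hy, rfl⟩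
       exact ⟨x + y, (I : Submodule R L).add_mem hx hy, map_add s x y⟩
     zero_mem' := ⟨0, (I : Submodule R L).zero_mem, map_zero s⟩
     smul_mem' := by
       rintro r _ ⟨x, hx, rfl⟩
       refine ⟨g.symm r • x, (I : Submodule R L).smul_mem _ hx, ?_⟩
       rw [Algebra.smul_def, Algebra.smul_def, map_mul, hs, RingEquiv.apply_symm_apply] },
    by
      obtain ⟨a, ha, h⟩ := I.isFractional
      refine ⟨g a, ?_, ?_⟩
      · rw [mem_nonZeroDivisors_iff_ne_zero] at ha ⊢
        simpa using ha
      · rintro _ ⟨x, hx, rfl⟩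
        obtain ⟨r, hr⟩ := h x hx
        refine ⟨g r, ?_⟩
        rw [Algebra.smul_def] at hr ⊢
        rw [← hs, ← hs, hr, map_mul]⟩

theorem FractionalIdeal.mem_image {s : L ≃+* L} {g : R ≃+* R}
    {hs : ∀ r, s (algebraMap R L r) = algebraMap R L (g r)} {I : FractionalIdeal R⁰ L} {x : L} :
    x ∈ FractionalIdeal.image s g hs I ↔ ∃ y ∈ I, s y = x := Iff.rfl

/-- The action `I ↦ s(I)` on `𝓕(R)`. -/
def FracMon.act (s : L ≃+* L) (g : R ≃+* R)
    (hs : ∀ r, s (algebraMap R L r) = algebraMap R L (g r)) : FracMon R L →* FracMon R L where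
  toFun I := ⟨FractionalIdeal.image s g hs I, fun h => I.2 (FractionalIdeal.eq_zero_iff.2
    fun x hx => s.injective
      ((FractionalIdeal.eq_zero_iff.1 h _ ⟨x, hx, rfl⟩).trans (map_zero s).symm))⟩
  map_one' := by
    refine Subtype.ext (FractionalIdeal.ext fun x => ?_)
    change x ∈ FractionalIdeal.image s g hs 1 ↔ x ∈ (1 : FractionalIdeal R⁰ L)
    simp only [FractionalIdeal.mem_image, FractionalIdeal.mem_one_iff]
    constructor
    · rintro ⟨_, ⟨r, rfl⟩, rfl⟩
      exact ⟨g r, (hs r).symm⟩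
    · rintro ⟨r, rfl⟩
      exact ⟨_, ⟨g.symm r, rfl⟩, by rw [hs, RingEquiv.apply_symm_apply]⟩
  map_mul' I J := by
    refine Subtype.ext (le_antisymm ?_ (FractionalIdeal.mul_le.2 ?_))
    · rintro _ ⟨z, hz, rfl⟩
      change s z ∈ FractionalIdeal.image s g hs I * FractionalIdeal.image s g hs J
      refine FractionalIdeal.mul_induction_on hz (fun x hx y hy => ?_) (fun x y hx hy => ?_)
      · rw [map_mul]
        exact FractionalIdeal.mul_mem_mul ⟨x, hx, rfl⟩ ⟨y, hy, rfl⟩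
      · rw [map_add]
        exact (_ : Submodule R L).add_mem hx hy
    · rintro _ ⟨x, hx, rfl⟩ _ ⟨y, hy, rfl⟩
      exact ⟨x * y, FractionalIdeal.mul_mem_mul hx hy, map_mul s x y⟩

/-- The induced action on `Cl(R)`. -/
def IdealCl.act (s : L ≃+* L) (g : R ≃+* R)
    (hs : ∀ r, s (algebraMap R L r) = algebraMap R L (g r)) : IdealCl R L →* IdealCl R L :=
  MonQuot.map (FracMon.act s g hs) (by
    rintro I ⟨a, ha, hI⟩
    refine ⟨s a, by simpa using ha, fun x => ?_⟩
    change x ∈ FractionalIdeal.image s g hs I ↔ _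
    simp only [FractionalIdeal.mem_image, hI]
    constructor
    · rintro ⟨_, ⟨r, rfl⟩, rfl⟩
      exact ⟨g r, by rw [map_mul, hs]⟩
    · rintro ⟨r, rfl⟩
      exact ⟨_, ⟨g.symm r, rfl⟩, by rw [map_mul, hs, RingEquiv.apply_symm_apply]⟩)

/-- The induced action on `Reg Cl(R) / Pic(R)`. -/
def RegClModPic.act (s : L ≃+* L) (g : R ≃+* R)
    (hs : ∀ r, s (algebraMap R L r) = algebraMap R L (g r)) :
    RegClModPic R L →* RegClModPic R L :=
  MonQuot.map (Reg.map (IdealCl.act s g hs)) (by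
    rintro ⟨_, hc⟩ ⟨I, hI, rfl⟩
    exact ⟨FracMon.act s g hs I, IsUnit.map _ hI, rfl⟩)

end Action

/-! ### The ring `𝔒`, its valuations, and the Galois action -/

section Valuations

variable (𝔬 K L : Type*) [CommRing 𝔬] [IsDedekindDomain 𝔬] [Field K] [Algebra 𝔬 K]
  [IsFractionRing 𝔬 K] [Field L] [Algebra K L] [Algebra 𝔬 L] [IsScalarTower 𝔬 K L]

variable {𝔬 L}

/-- `x ∈ L` lies in the localization `𝔒_𝔓` of `𝔒` (the integral closure of `𝔬` in `L`). -/
def MemLocAt (P : MaximalSpectrum (integralClosure 𝔬 L)) (x : L) : Prop :=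
  ∃ a s : integralClosure 𝔬 L, s ∉ P.asIdeal ∧ x * (s : L) = (a : L)

/-- `v : Lˣ → ℚ` is the additive valuation of `L` corresponding to the maximal ideal `𝔓` of `𝔒`
(that is, with valuation ring `𝔒_𝔓`), normalized by `v(Kˣ) = ℤ`. -/
structure IsNormalizedValuation (P : MaximalSpectrum (integralClosure 𝔬 L))
    (v : Additive Lˣ →+ ℚ) : Prop where
  /-- `v (x + y) ≥ min (v x) (v y)` -/
  min_le_add : ∀ x y z : Lˣ, (x : L) + y = z →
    min (v (Additive.ofMul x)) (v (Additive.ofMul y)) ≤ v (Additive.ofMul z)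
  /-- the valuation ring of `v` is `𝔒_𝔓` -/
  nonneg_iff : ∀ x : Lˣ, 0 ≤ v (Additive.ofMul x) ↔ MemLocAt P (x : L)
  /-- `v(Kˣ) = ℤ` -/
  map_base : ∀ q : ℚ, (∃ k : Kˣ, v (Additive.ofMul (Units.map (algebraMap K L : K →* L) k)) = q) ↔
    ∃ n : ℤ, (n : ℚ) = q

variable {K}

theorem MemLocAt.mul {P : MaximalSpectrum (integralClosure 𝔬 L)} {x y : L}
    (hx : MemLocAt P x) (hy : MemLocAt P y) : MemLocAt P (x * y) := by
  obtain ⟨a, s, hs, h⟩ := hx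
  obtain ⟨b, t, ht, h'⟩ := hy
  refine ⟨a * b, s * t, fun hst => ?_, ?_⟩
  · exact (P.isMaximal.isPrime.mem_or_mem hst).elim hs ht
  · push_cast
    rw [← h, ← h']
    ring

theorem MemLocAt.add {P : MaximalSpectrum (integralClosure 𝔬 L)} {x y : L}
    (hx : MemLocAt P x) (hy : MemLocAt P y) : MemLocAt P (x + y) := by
  obtain ⟨a, s, hs, h⟩ := hx
  obtain ⟨b, t, ht, h'⟩ := hy
  refine ⟨a * t + b * s, s * t, fun hst => ?_, ?_⟩
  · exact (P.isMaximal.isPrime.mem_or_mem hst).elim hs ht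
  · push_cast
    rw [← h, ← h']
    ring

theorem MemLocAt.one (P : MaximalSpectrum (integralClosure 𝔬 L)) : MemLocAt P (1 : L) :=
  ⟨1, 1, fun h => P.isMaximal.ne_top ((Ideal.eq_top_iff_one _).2 h), by simp⟩

theorem MemLocAt.pow {P : MaximalSpectrum (integralClosure 𝔬 L)} {x : L}
    (hx : MemLocAt P x) (n : ℕ) : MemLocAt P (x ^ n) := by
  induction n with
  | zero => simpa using MemLocAt.one P
  | succ n ih => rw [pow_succ]; exact ih.mul hx

variable [IsGalois K L]

/-- The prime `𝔭 = 𝔓 ∩ 𝔬` of `𝔬` below `𝔓`. -/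
def primeBelow (ho : ¬ IsField 𝔬) (P : MaximalSpectrum (integralClosure 𝔬 L)) :
    IsDedekindDomain.HeightOneSpectrum 𝔬 where
  asIdeal := P.asIdeal.comap (algebraMap 𝔬 (integralClosure 𝔬 L))
  isPrime := by
    have := P.isMaximal.isPrime
    exact Ideal.comap_isPrime _ _
  ne_bot := by
    have := P.isMaximal
    exact Ring.ne_bot_of_isMaximal_of_not_isField
      (Ideal.isMaximal_comap_of_isIntegral_of_isMaximal P.asIdeal) ho

/-- An element of `K` lies in `𝔒_𝔓` iff it is `𝔭`-integral. -/
theorem memLocAt_base_iff (ho : ¬ IsField 𝔬)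
    (P : MaximalSpectrum (integralClosure 𝔬 L)) (k : K) :
    MemLocAt P (algebraMap K L k) ↔ (primeBelow ho P).valuation K k ≤ 1 := by
  have hmap : ∀ r : 𝔬, ((algebraMap 𝔬 (integralClosure 𝔬 L) r : integralClosure 𝔬 L) : L)
      = algebraMap K L (algebraMap 𝔬 K r) := fun r => by
    rw [← IsScalarTower.algebraMap_apply]; rfl
  constructor
  · rintro ⟨a, s, hs, h⟩
    by_contra! hk
    have hk0 : k ≠ 0 := by rintro rfl; simp at hk
    have hk' : (primeBelow ho P).valuation K k⁻¹ < 1 := by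
      rw [map_inv₀]
      exact inv_lt_one_of_one_lt₀ hk
    obtain ⟨n, d, hnd⟩ := (primeBelow ho P).exists_primeCompl_mul_eq_of_integer k⁻¹ hk'.le
    have hn : n ∈ (primeBelow ho P).asIdeal := by
      rw [← IsDedekindDomain.HeightOneSpectrum.valuation_lt_one_iff_mem (K := K)]
      change (primeBelow ho P).valuation K (algebraMap 𝔬 K n) < 1
      rw [← hnd, map_mul]
      exact mul_lt_one_of_lt_of_le hk' ((primeBelow ho P).valuation_le_one _)
    have e : algebraMap 𝔬 (integralClosure 𝔬 L) d * s = a * algebraMap 𝔬 _ n := by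
      apply Subtype.ext
      push_cast [hmap]
      rw [← h, ← hnd, map_mul, map_inv₀]
      have : algebraMap K L k ≠ 0 := by simpa using hk0
      field_simp
    have : algebraMap 𝔬 (integralClosure 𝔬 L) d * s ∈ P.asIdeal :=
      e ▸ P.asIdeal.mul_mem_left a hn
    exact (P.isMaximal.isPrime.mem_or_mem this).elim d.2 hs
  · intro hk
    obtain ⟨n, d, hnd⟩ := (primeBelow ho P).exists_primeCompl_mul_eq_of_integer k hk
    refine ⟨algebraMap 𝔬 _ n, algebraMap 𝔬 _ (d : 𝔬), d.2, ?_⟩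
    rw [hmap, hmap, ← hnd, map_mul]

/-- Every element of `L` has a power that is, up to units of `𝔒_𝔓`, an element of `K`. -/
theorem exists_pow_mul_base (ho : ¬ IsField 𝔬)
    (P : MaximalSpectrum (integralClosure 𝔬 L)) (x : Lˣ) :
    (MemLocAt P (x : L) ∨ MemLocAt P ((x⁻¹ : Lˣ) : L)) ∧
    ∃ (n : ℕ) (k : Kˣ), 0 < n ∧ MemLocAt P ((x : L) ^ n * (algebraMap K L k)⁻¹) ∧
      MemLocAt P (((x : L) ^ n)⁻¹ * algebraMap K L k) := by
  have hx : IsIntegral K (x : L) := Algebra.IsIntegral.isIntegral _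
  let M := IntermediateField.adjoin K {(x : L)}
  have : FiniteDimensional K M := IntermediateField.adjoin.finiteDimensional hx
  have : IsScalarTower 𝔬 M L := IsScalarTower.of_algebraMap_eq fun _ => rfl
  let B := integralClosure 𝔬 M
  have : IsDedekindDomain B := integralClosure.isDedekindDomain 𝔬 K M
  have : IsFractionRing B M := IsIntegralClosure.isFractionRing_of_finite_extension 𝔬 K M B
  let f : B →+* integralClosure 𝔬 L :=
    { toFun := fun b => ⟨((b : M) : L), (IsIntegral.map (IsScalarTower.toAlgHom 𝔬 M L) b.2)⟩
      map_one' := rfl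
      map_mul' := fun _ _ => rfl
      map_zero' := rfl
      map_add' := fun _ _ => rfl }
  have hf : ∀ r : 𝔬, f (algebraMap 𝔬 B r) = algebraMap 𝔬 _ r := fun r => by
    apply Subtype.ext
    exact (IsScalarTower.algebraMap_apply 𝔬 M L r).symm
  obtain ⟨p, hp, hp0⟩ := Submodule.exists_mem_ne_zero_of_ne_bot (primeBelow ho P).ne_bot
  have hinj : Function.Injective (algebraMap 𝔬 B) := by
    have : Function.Injective (algebraMap 𝔬 M) := by
      rw [IsScalarTower.algebraMap_eq 𝔬 K M]
      exact (algebraMap K M).injective.comp (IsFractionRing.injective 𝔬 K)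
    exact fun a b h => this (congrArg (Subtype.val : B → M) h)
  let Q : IsDedekindDomain.HeightOneSpectrum B :=
    { asIdeal := P.asIdeal.comap f
      isPrime := by
        have := P.isMaximal.isPrime
        exact Ideal.comap_isPrime _ _
      ne_bot := fun h => by
        have h1 : algebraMap 𝔬 B p ∈ P.asIdeal.comap f := by
          rw [Ideal.mem_comap, hf]; exact hp
        rw [h, Ideal.mem_bot] at h1
        exact hp0 (hinj (h1.trans (map_zero _).symm)) }
  have hloc : ∀ y : M, Q.valuation M y ≤ 1 → MemLocAt P (y : L) := by
    intro y hy
    obtain ⟨n, d, hnd⟩ := Q.exists_primeCompl_mul_eq_of_integer y hy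
    exact ⟨f n, f d, d.2, congrArg (Subtype.val : M → L) hnd⟩
  let y : M := ⟨x, IntermediateField.mem_adjoin_simple_self K _⟩
  have hy0 : y ≠ 0 := fun h => x.ne_zero (congrArg Subtype.val h)
  let π : M := algebraMap B M (algebraMap 𝔬 B p)
  have hπ0 : π ≠ 0 := fun h => hp0 (hinj (IsFractionRing.injective B M (by simpa [π] using h)))
  have hπ1 : Q.valuation M π < 1 := by
    rw [IsDedekindDomain.HeightOneSpectrum.valuation_lt_one_iff_mem]
    change f (algebraMap 𝔬 B p) ∈ P.asIdeal
    rw [hf]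
    exact hp
  have hvy : Q.valuation M y ≠ 0 := by simpa using hy0
  have hvπ : Q.valuation M π ≠ 0 := by simpa using hπ0
  obtain ⟨a, ha⟩ : ∃ a : ℤ, Q.valuation M y = WithZero.exp a :=
    ⟨_, (WithZero.exp_log hvy).symm⟩
  obtain ⟨b, hb⟩ : ∃ b : ℤ, Q.valuation M π = WithZero.exp b :=
    ⟨_, (WithZero.exp_log hvπ).symm⟩
  have hb0 : b < 0 := by
    rw [hb, ← WithZero.exp_zero, WithZero.exp_lt_exp] at hπ1
    exact hπ1
  refine ⟨?_, b.natAbs, Units.mk0 (algebraMap 𝔬 K p) (by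
    simpa using hp0) ^ (-a), by omega, ?_, ?_⟩
  · rcases le_total (Q.valuation M y) 1 with h | h
    · exact Or.inl (hloc y h)
    · refine Or.inr ?_
      have := hloc y⁻¹ (by rw [map_inv₀]; exact inv_le_one_of_one_le₀ h)
      simpa [y] using this
  all_goals
    have hπL : ((π : M) : L) = algebraMap K L (algebraMap 𝔬 K p) := by
      rw [← IsScalarTower.algebraMap_apply 𝔬 K L]
      exact (IsScalarTower.algebraMap_apply 𝔬 M L p).symm
    have hπz : ((π ^ a : M) : L) = ((π : M) : L) ^ a := map_zpow₀ (algebraMap M L) π a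
    have hval : Q.valuation M (y ^ b.natAbs * π ^ a) = 1 := by
      rw [map_mul, map_pow, map_zpow₀, ha, hb, ← WithZero.exp_nsmul, ← WithZero.exp_zsmul,
        ← WithZero.exp_add, ← WithZero.exp_zero]
      congr 1
      have : (b.natAbs : ℤ) = -b := by omega
      rw [nsmul_eq_mul, this]
      simp [mul_comm]
  · have := hloc _ hval.le
    simpa [y, hπL, hπz, zpow_neg] using this
  · have := hloc (y ^ b.natAbs * π ^ a)⁻¹ (by rw [map_inv₀, hval, inv_one])
    simpa [y, hπL, hπz, zpow_neg, mul_comm] using this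

/-- The `𝔭`-adic order on `Kˣ`. -/
noncomputable def ordBase (p : IsDedekindDomain.HeightOneSpectrum 𝔬) (k : Kˣ) : ℤ :=
  -(p.valuation K (k : K)).log

theorem ordBase_mul (p : IsDedekindDomain.HeightOneSpectrum 𝔬) (k l : Kˣ) :
    ordBase p (k * l) = ordBase p k + ordBase p l := by
  simp [ordBase, WithZero.log_mul, add_comm]

theorem ordBase_pow (p : IsDedekindDomain.HeightOneSpectrum 𝔬) (k : Kˣ) (n : ℕ) :
    ordBase p (k ^ n) = n * ordBase p k := by
  simp [ordBase, WithZero.log_pow]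

theorem ordBase_inv (p : IsDedekindDomain.HeightOneSpectrum 𝔬) (k : Kˣ) :
    ordBase p k⁻¹ = - ordBase p k := by
  simp [ordBase, WithZero.log_inv]

theorem ordBase_nonneg (p : IsDedekindDomain.HeightOneSpectrum 𝔬) (k : Kˣ) :
    0 ≤ ordBase p k ↔ p.valuation K (k : K) ≤ 1 := by
  have : p.valuation K (k : K) ≠ 0 := by simp
  rw [ordBase, neg_nonneg, ← WithZero.log_one, WithZero.log_le_log this one_ne_zero]

theorem ordBase_surjective (p : IsDedekindDomain.HeightOneSpectrum 𝔬) (n : ℤ) :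
    ∃ k : Kˣ, ordBase p k = n := by
  obtain ⟨x, hx⟩ := p.valuation_surjective K (WithZero.exp (-n))
  have hx0 : x ≠ 0 := by
    rintro rfl
    exact WithZero.exp_ne_zero (hx.symm.trans (map_zero _))
  exact ⟨Units.mk0 x hx0, by simp [ordBase, hx]⟩

theorem ordBase_nonneg_iff (ho : ¬ IsField 𝔬) (P : MaximalSpectrum (integralClosure 𝔬 L))
    (k : Kˣ) : 0 ≤ ordBase (primeBelow ho P) k ↔ MemLocAt P (algebraMap K L k) := by
  rw [ordBase_nonneg, memLocAt_base_iff ho]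

/-- Auxiliary relation, used to construct the valuation: up to a unit of `𝔒_𝔓`, `x ^ n` is an
element `k` of `K` of order `r * n`. -/
def HasVal (K : Type*) {𝔬 L : Type*} [CommRing 𝔬] [IsDedekindDomain 𝔬] [Field K] [Algebra 𝔬 K]
    [IsFractionRing 𝔬 K] [Field L] [Algebra K L] [Algebra 𝔬 L]
    (ho : ¬ IsField 𝔬) (P : MaximalSpectrum (integralClosure 𝔬 L)) (x : Lˣ) (r : ℚ) : Prop :=
  ∃ (n : ℕ) (k : Kˣ), 0 < n ∧ MemLocAt P ((x : L) ^ n * (algebraMap K L k)⁻¹) ∧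
    MemLocAt P (((x : L) ^ n)⁻¹ * algebraMap K L k) ∧ r * n = ordBase (primeBelow ho P) k

theorem HasVal.exists (ho : ¬ IsField 𝔬) (P : MaximalSpectrum (integralClosure 𝔬 L)) (x : Lˣ) :
    ∃ r, HasVal K ho P x r := by
  obtain ⟨-, n, k, hn, h1, h2⟩ := exists_pow_mul_base (K := K) ho P x
  have : (n : ℚ) ≠ 0 := by positivity
  exact ⟨ordBase (primeBelow ho P) k / n, n, k, hn, h1, h2, by field_simp⟩

theorem HasVal.mul {ho : ¬ IsField 𝔬} {P : MaximalSpectrum (integralClosure 𝔬 L)} {x y : Lˣ}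
    {r t : ℚ} (hx : HasVal K ho P x r) (hy : HasVal K ho P y t) :
    HasVal K ho P (x * y) (r + t) := by
  obtain ⟨n, k, hn, h1, h2, h⟩ := hx
  obtain ⟨m, l, hm, h1', h2', h'⟩ := hy
  refine ⟨n * m, k ^ m * l ^ n, by positivity, ?_, ?_, ?_⟩
  · convert (h1.pow m).mul (h1'.pow n) using 1
    simp only [Units.val_mul, Units.val_pow_eq_pow_val, map_mul, map_pow, mul_pow, mul_inv,
      inv_pow, ← pow_mul]
    ring
  · convert (h2.pow m).mul (h2'.pow n) using 1
    simp only [Units.val_mul, Units.val_pow_eq_pow_val, map_mul, map_pow, mul_pow, mul_inv,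
      inv_pow, ← pow_mul]
    ring
  · rw [ordBase_mul, ordBase_pow, ordBase_pow]
    push_cast
    rw [← h, ← h']
    ring

theorem HasVal.inv {ho : ¬ IsField 𝔬} {P : MaximalSpectrum (integralClosure 𝔬 L)} {x : Lˣ}
    {r : ℚ} (hx : HasVal K ho P x r) : HasVal K ho P x⁻¹ (-r) := by
  obtain ⟨n, k, hn, h1, h2, h⟩ := hx
  refine ⟨n, k⁻¹, hn, by simpa using h2, by simpa using h1, ?_⟩
  rw [ordBase_inv]
  push_cast
  rw [← h]
  ring

theorem HasVal.nonneg_iff {ho : ¬ IsField 𝔬} {P : MaximalSpectrum (integralClosure 𝔬 L)} {x : Lˣ}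
    {r : ℚ} (hx : HasVal K ho P x r) : 0 ≤ r ↔ MemLocAt P (x : L) := by
  obtain ⟨n, k, hn, h1, h2, h⟩ := hx
  have hn' : (0 : ℚ) < n := by positivity
  have hrk : 0 ≤ r ↔ MemLocAt P (algebraMap K L k) := by
    rw [← ordBase_nonneg_iff ho, ← Int.cast_nonneg_iff (R := ℚ), ← h, mul_nonneg_iff_of_pos_right hn']
  have hk0 : algebraMap K L k ≠ 0 := by simp
  have hx0 : (x : L) ≠ 0 := x.ne_zero
  rw [hrk]
  constructor
  · intro hk
    have hxn : MemLocAt P ((x : L) ^ n) := by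
      convert h1.mul hk using 1
      field_simp
    by_contra hc
    obtain ⟨a, s, hs, e⟩ := (exists_pow_mul_base (K := K) ho P x).1.resolve_left hc
    obtain ⟨b, t, ht, e'⟩ := hxn
    have ha : a ∈ P.asIdeal := by
      by_contra ha
      refine hc ⟨s, a, ha, ?_⟩
      rw [← e]
      simp
    have e2 : s ^ n * t = a ^ n * b := by
      apply Subtype.ext
      push_cast
      rw [← e, ← e', mul_pow, Units.val_inv_eq_inv_val, inv_pow]
      field_simp
    have : s ^ n * t ∈ P.asIdeal := by
      rw [e2]
      exact P.asIdeal.mul_mem_right _ (P.asIdeal.pow_mem_of_mem ha n hn)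
    rcases P.isMaximal.isPrime.mem_or_mem this with h | h
    · exact hs (P.isMaximal.isPrime.mem_of_pow_mem n h)
    · exact ht h
  · intro hx
    convert h2.mul (hx.pow n) using 1
    field_simp

theorem HasVal.unique {ho : ¬ IsField 𝔬} {P : MaximalSpectrum (integralClosure 𝔬 L)} {x : Lˣ}
    {r t : ℚ} (hx : HasVal K ho P x r) (hy : HasVal K ho P x t) : r = t := by
  have h1 := (hx.mul hy.inv).nonneg_iff.2 (by simpa using MemLocAt.one P)
  have h2 := (hy.mul hx.inv).nonneg_iff.2 (by simpa using MemLocAt.one P)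
  linarith

theorem HasVal.base (ho : ¬ IsField 𝔬) (P : MaximalSpectrum (integralClosure 𝔬 L)) (k : Kˣ) :
    HasVal K ho P (Units.map (algebraMap K L : K →* L) k) (ordBase (primeBelow ho P) k) :=
  ⟨1, k, one_pos, by simpa using MemLocAt.one P, by simpa using MemLocAt.one P, by simp⟩

variable (K) in
/-- There is an additive valuation of `L` corresponding to `𝔓` and normalized by `v(Kˣ) = ℤ`. -/
theorem exists_isNormalizedValuation (ho : ¬ IsField 𝔬)
    (P : MaximalSpectrum (integralClosure 𝔬 L)) :
    ∃ v : Additive Lˣ →+ ℚ, IsNormalizedValuation K P v := by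
  choose v hv using HasVal.exists (K := K) ho P
  have hmul : ∀ x y, v (x * y) = v x + v y := fun x y =>
    (hv (x * y)).unique ((hv x).mul (hv y))
  have hbase : ∀ k, v (Units.map (algebraMap K L : K →* L) k) = ordBase (primeBelow ho P) k :=
    fun k => (hv _).unique (HasVal.base ho P k)
  have hle : ∀ x y : Lˣ, v x ≤ v y ↔ MemLocAt P ((y : L) * (x : L)⁻¹) := fun x y => by
    have := ((hv y).mul (hv x).inv).nonneg_iff
    rw [← sub_eq_add_neg, sub_nonneg] at this
    simpa using this
  refine ⟨AddMonoidHom.mk' (fun x => v x.toMul) fun x y => hmul _ _, ?_, ?_, ?_⟩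
  · intro x y z h
    change min (v x) (v y) ≤ v z
    rcases le_total (v x) (v y) with hxy | hxy
    · rw [min_eq_left hxy, hle]
      convert (MemLocAt.one P).add ((hle _ _).1 hxy) using 1
      rw [← h]
      field_simp
    · rw [min_eq_right hxy, hle]
      convert ((hle _ _).1 hxy).add (MemLocAt.one P) using 1
      rw [← h]
      field_simp
  · exact fun x => (hv x).nonneg_iff
  · intro q
    constructor
    · rintro ⟨k, rfl⟩
      exact ⟨_, (hbase k).symm⟩
    · rintro ⟨n, rfl⟩
      obtain ⟨k, hk⟩ := ordBase_surjective (K := K) (primeBelow ho P) n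
      exact ⟨k, by rw [← hk]; exact hbase k⟩

/-- Such a valuation is unique. -/
theorem IsNormalizedValuation.unique (ho : ¬ IsField 𝔬)
    {P : MaximalSpectrum (integralClosure 𝔬 L)} {v w : Additive Lˣ →+ ℚ}
    (hv : IsNormalizedValuation K P v) (hw : IsNormalizedValuation K P w) : v = w := by
  suffices H : ∀ v : Additive Lˣ →+ ℚ, IsNormalizedValuation K P v →
      ∀ x : Lˣ, HasVal K ho P x (v (Additive.ofMul x)) by
    exact AddMonoidHom.ext fun x => (H v hv x.toMul).unique (H w hw x.toMul)
  clear hv hw v w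
  intro v hv x
  let i : Kˣ →* Lˣ := Units.map (algebraMap K L : K →* L)
  have hbase0 : ∀ k : Kˣ, 0 ≤ v (.ofMul (i k)) ↔ 0 ≤ ordBase (primeBelow ho P) k := fun k => by
    rw [hv.nonneg_iff, ordBase_nonneg_iff ho]
    rfl
  have hunit : ∀ k : Kˣ, ordBase (primeBelow ho P) k = 0 → v (.ofMul (i k)) = 0 := by
    intro k hk
    have h1 := (hbase0 k).2 hk.ge
    have h2 := (hbase0 k⁻¹).2 (by rw [ordBase_inv, hk, neg_zero])
    rw [map_inv, ofMul_inv, map_neg] at h2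
    linarith
  obtain ⟨p, hp⟩ := ordBase_surjective (K := K) (primeBelow ho P) 1
  have hzpow : ∀ (m : ℤ), ordBase (primeBelow ho P) (p ^ m) = m := by
    intro m
    simp only [ordBase, Units.val_zpow_eq_zpow_val, map_zpow₀, WithZero.log_zpow] at hp ⊢
    simp only [smul_eq_mul]
    rw [← mul_neg, hp, mul_one]
  have hlin : ∀ k : Kˣ, v (.ofMul (i k)) = ordBase (primeBelow ho P) k * v (.ofMul (i p)) := by
    intro k
    have := hunit (k * p ^ (-ordBase (primeBelow ho P) k)) (by
      rw [ordBase_mul, hzpow, add_neg_cancel])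
    rw [map_mul, map_zpow, ofMul_mul, ofMul_zpow, map_add, map_zsmul, zsmul_eq_mul] at this
    push_cast at this
    linarith
  have hp1 : v (.ofMul (i p)) = 1 := by
    obtain ⟨n, hn⟩ := (hv.map_base _).1 ⟨p, rfl⟩
    obtain ⟨k, hk⟩ := (hv.map_base 1).2 ⟨1, by simp⟩
    have h0 := (hbase0 p).2 (by rw [hp]; exact zero_le_one)
    have e := hlin k
    rw [show v (.ofMul (i k)) = 1 from hk, show v (.ofMul (i p)) = n from hn.symm] at e
    rw [show v (.ofMul (i p)) = n from hn.symm] at h0 ⊢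
    have e' : (1 : ℤ) = ordBase (primeBelow ho P) k * n := by exact_mod_cast e
    have h0' : 0 ≤ n := by exact_mod_cast h0
    exact_mod_cast Int.eq_one_of_mul_eq_one_left h0' e'.symm
  obtain ⟨-, n, k, hn, h1, h2⟩ := exists_pow_mul_base (K := K) ho P x
  refine ⟨n, k, hn, h1, h2, ?_⟩
  have e1 := (hv.nonneg_iff (x ^ n * (i k)⁻¹)).2 (by simpa [i] using h1)
  have e2 := (hv.nonneg_iff ((x ^ n)⁻¹ * i k)).2 (by simpa [i] using h2)
  rw [ofMul_mul, ofMul_inv, ofMul_pow, map_add, map_neg, map_nsmul, nsmul_eq_mul] at e1 e2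
  have e3 := hlin k
  rw [hp1, mul_one] at e3
  rw [← e3]
  linarith

variable (K) in
/-- The additive valuation `v_𝔓 : Lˣ → ℚ` corresponding to `𝔓`, normalized by `v_𝔓(Kˣ) = ℤ`. -/
noncomputable def normVal (ho : ¬ IsField 𝔬) (P : MaximalSpectrum (integralClosure 𝔬 L)) :
    Additive Lˣ →+ ℚ :=
  (exists_isNormalizedValuation K ho P).choose

variable (K) in
theorem normVal_spec (ho : ¬ IsField 𝔬) (P : MaximalSpectrum (integralClosure 𝔬 L)) :
    IsNormalizedValuation K P (normVal K ho P) :=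
  (exists_isNormalizedValuation K ho P).choose_spec

variable (K) in
/-- The value group `v_𝔓(Lˣ)`, as a subgroup of `ℝ`. -/
noncomputable def valGroup (ho : ¬ IsField 𝔬) (P : MaximalSpectrum (integralClosure 𝔬 L)) :
    AddSubgroup ℝ :=
  ((Rat.castHom ℝ).toAddMonoidHom.comp (normVal K ho P)).range

end Valuations

/-! ### Galois theory of `𝔒` -/

section Galois

variable {𝔬 K L : Type*} [CommRing 𝔬] [IsDedekindDomain 𝔬] [Field K] [Algebra 𝔬 K]
  [IsFractionRing 𝔬 K] [Field L] [Algebra K L] [Algebra 𝔬 L] [IsScalarTower 𝔬 K L]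
  [IsGalois K L]

variable (𝔬) in
/-- The restriction of `σ ∈ Gal(L/K)` to an automorphism of the ring `𝔒`. -/
noncomputable def galRing (σ : Gal(L/K)) : integralClosure 𝔬 L ≃+* integralClosure 𝔬 L :=
  (galRestrict 𝔬 K L (integralClosure 𝔬 L) σ).toRingEquiv

theorem coe_galRing (σ : Gal(L/K)) (x : integralClosure 𝔬 L) :
    ((galRing 𝔬 σ x : integralClosure 𝔬 L) : L) = σ (x : L) :=
  algebraMap_galRestrict_apply 𝔬 σ x

variable (K) in
/-- The decomposition group `{σ ∈ Gal(L/K) | σ(𝔓) = 𝔓}` of a maximal ideal `𝔓` of `𝔒`. -/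
def decompGroup (P : MaximalSpectrum (integralClosure 𝔬 L)) : Subgroup Gal(L/K) where
  carrier := {σ | ∀ x, galRing 𝔬 σ x ∈ P.asIdeal ↔ x ∈ P.asIdeal}
  one_mem' x := by
    rw [show galRing 𝔬 (1 : Gal(L/K)) x = x from Subtype.ext (coe_galRing _ _)]
  mul_mem' := by
    intro σ τ hσ hτ x
    rw [show galRing 𝔬 (σ * τ) x = galRing 𝔬 σ (galRing 𝔬 τ x) from
      Subtype.ext (by simp [coe_galRing]), hσ, hτ]
  inv_mem' := by
    intro σ hσ x
    rw [← hσ, show galRing 𝔬 σ (galRing 𝔬 σ⁻¹ x) = x from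
      Subtype.ext (by rw [coe_galRing, coe_galRing, ← AlgEquiv.mul_apply]; simp)]

/-- The action of `σ ∈ Gal(L/K)` on `Reg Cl(𝔒) / Pic(𝔒)` induced by `I ↦ σ(I)`. -/
noncomputable def galAct (σ : Gal(L/K)) :
    RegClModPic (integralClosure 𝔬 L) L →* RegClModPic (integralClosure 𝔬 L) L :=
  RegClModPic.act (σ : L ≃+* L) (galRing 𝔬 σ) fun r => (coe_galRing σ r).symm

variable (K) in
/-- The set `R^∞_{L/K}(𝔬)` of all `𝔮` such that the value group `v_{𝔮,L}(Lˣ)` differs from its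
closure `V_𝔮` in `ℝ`, where `v_{𝔮,L}` is the valuation at the chosen maximal ideal `𝔮_L`. -/
def RamInf (ho : ¬ IsField 𝔬) (pL : MaximalSpectrum 𝔬 → MaximalSpectrum (integralClosure 𝔬 L)) :
    Set (MaximalSpectrum 𝔬) :=
  {q | (valGroup K ho (pL q) : Set ℝ) ≠ closure (valGroup K ho (pL q) : Set ℝ)}

end Galois

/-- The finite character property: every non-zero element of `R` is contained in at most finitely
many maximal ideals. -/
def FiniteCharacter (R : Type*) [CommRing R] : Prop :=
  ∀ x : R, x ≠ 0 → {P : MaximalSpectrum R | x ∈ P.asIdeal}.Finite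

/-! ### Upper sets of a subgroup of the real numbers -/

section Cuts

open scoped Pointwise

/-! A non-zero fractional ideal `I` is studied through its value sets `valSet` at the maximal ideals
`P` of 𝔒. Each is a cut of the value group Γ_P: non-empty, bounded below and upward closed
(`isCut_valSet`). The cuts determine `I` by a local-global argument (`eq_of_forall_valSet_eq`),
multiplication of ideals becomes addition of cuts (`valSet_mul`), and by finite character almost all
cuts are the trivial one, Γ_P ∩ [0, ∞) (`finite_valSet_ne`).

Up to translation by Γ_P, a cut either has a least element or is given by its unattained infimum
modulo Γ_P. This is the invariant `infClass` in {0} ⊔ ℝ/Γ_P, and it is additive (`infClass_add`). If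
Γ_P is not dense, every infimum is attained and the place contributes nothing; if Γ_P is dense,
every real r is the unattained infimum of Γ_P ∩ (r, ∞). Collecting the invariants gives a
homomorphism `localClass` from 𝓕(𝔒) onto the direct sum.

Two ideals with the same image have cuts that are translates of each other, non-trivially at only
finitely many places. These translations are realized by an invertible ideal, a product of ideals
`closedCutIdeal` (`exists_isUnit_mul_eq`). So `localClass` is the quotient map modulo invertible
ideals. Its target consists of regular elements, which forces every class in Cl(𝔒) to be regular, so
that Reg Cl(𝔒)/Pic(𝔒) is 𝓕(𝔒)/𝓘(𝔒) (`exists_regQuot_mulEquiv`).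

The indexing by cosets comes from the transitivity of G on the maximal ideals above 𝔭
(`exists_galMax_eq`); equivariance comes from uniqueness of normalized valuations, which gives
v_{σP} ∘ σ = v_P (`normVal_galMax`). -/

/-- `S` is a non-empty, bounded below, upward closed subset of `G`. -/
structure IsCut (G : AddSubgroup ℝ) (S : Set ℝ) : Prop where
  nonempty : S.Nonempty
  bddBelow : BddBelow S
  subset : S ⊆ G
  upper : ∀ s ∈ S, ∀ g ∈ G, s ≤ g → g ∈ S

/-- The class of a cut `S` of `G`: the neutral element if `S` has a least element, and the class
of `sInf S` modulo `G` otherwise. -/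
noncomputable def infClass (G : AddSubgroup ℝ) (S : Set ℝ) : WithZero (ℝ ⧸ G) :=
  open Classical in if sInf S ∈ S then 0 else ((QuotientAddGroup.mk (sInf S) : ℝ ⧸ G) : WithZero _)

variable {G : AddSubgroup ℝ} {S T : Set ℝ}

theorem infClass_of_mem (h : sInf S ∈ S) : infClass G S = 0 :=
  if_pos h

theorem infClass_of_notMem (h : sInf S ∉ S) :
    infClass G S = ((QuotientAddGroup.mk (sInf S) : ℝ ⧸ G) : WithZero _) :=
  if_neg h

theorem infClass_of_isLeast {a : ℝ} (h : IsLeast S a) : infClass G S = 0 :=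
  infClass_of_mem (by rw [h.csInf_eq]; exact h.1)

/-- Infima add, and the infimum of the sumset is attained only if both infima are. If exactly one is
attained, it lies in `G` and disappears modulo `G`; hence the class of cuts with a minimum is
neutral. -/
theorem infClass_add (hS : IsCut G S) (hT : IsCut G T) :
    infClass G (S + T) = infClass G S + infClass G T := by
  have hinf : sInf (S + T) = sInf S + sInf T :=
    csInf_add hS.nonempty hS.bddBelow hT.nonempty hT.bddBelow
  have hmem : sInf (S + T) ∈ S + T ↔ sInf S ∈ S ∧ sInf T ∈ T := by
    rw [hinf]
    constructor
    · rintro ⟨a, ha, b, hb, h⟩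
      have h1 := csInf_le hS.bddBelow ha
      have h2 := csInf_le hT.bddBelow hb
      have h : a + b = sInf S + sInf T := h
      have e1 : a = sInf S := by linarith
      have e2 : b = sInf T := by linarith
      exact ⟨e1 ▸ ha, e2 ▸ hb⟩
    · rintro ⟨h1, h2⟩
      exact Set.add_mem_add h1 h2
  by_cases h1 : sInf S ∈ S <;> by_cases h2 : sInf T ∈ T
  · rw [infClass_of_mem (hmem.2 ⟨h1, h2⟩), infClass_of_mem h1, infClass_of_mem h2, add_zero]
  · rw [infClass_of_notMem (S := S + T) (by tauto), infClass_of_mem h1, infClass_of_notMem h2,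
      zero_add, hinf, WithZero.coe_inj, QuotientAddGroup.eq]
    convert G.neg_mem (hS.subset h1) using 1
    abel
  · rw [infClass_of_notMem (S := S + T) (by tauto), infClass_of_notMem h1, infClass_of_mem h2,
      add_zero, hinf, WithZero.coe_inj, QuotientAddGroup.eq]
    convert G.neg_mem (hT.subset h2) using 1
    abel
  · rw [infClass_of_notMem (S := S + T) (by tauto), infClass_of_notMem h1, infClass_of_notMem h2,
      hinf]
    rfl

/-- A cut is recovered from its infimum and from whether that infimum is attained. -/
theorem IsCut.mem_iff (hS : IsCut G S) {g : ℝ} (hg : g ∈ G) :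
    g ∈ S ↔ sInf S < g ∨ (g = sInf S ∧ sInf S ∈ S) := by
  constructor
  · intro h
    rcases (csInf_le hS.bddBelow h).lt_or_eq with h1 | h1
    · exact Or.inl h1
    · exact Or.inr ⟨h1.symm, h1 ▸ h⟩
  · rintro (h | ⟨h, h'⟩)
    · obtain ⟨s, hs, hsg⟩ := exists_lt_of_csInf_lt hS.nonempty h
      exact hS.upper s hs g hg hsg.le
    · exact h ▸ h'

theorem eq_singleton_add (hS : IsCut G S) (hT : IsCut G T)
    (hG : sInf T - sInf S ∈ G) (hST : sInf S ∈ S ↔ sInf T ∈ T) :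
    T = {sInf T - sInf S} + S := by
  ext g
  rw [Set.singleton_add, Set.mem_image]
  constructor
  · intro hg
    have hgG := hT.subset hg
    refine ⟨g - (sInf T - sInf S), ?_, by ring⟩
    rw [hS.mem_iff (G.sub_mem hgG hG)]
    rcases (hT.mem_iff hgG).1 hg with h | ⟨h, h'⟩
    · left; linarith
    · right; exact ⟨by linarith, hST.2 h'⟩
  · rintro ⟨s, hs, rfl⟩
    have hsG := hS.subset hs
    rw [hT.mem_iff (G.add_mem hG hsG)]
    rcases (hS.mem_iff hsG).1 hs with h | ⟨h, h'⟩
    · left; linarith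
    · right; exact ⟨by linarith, hST.1 h'⟩

/-- Two attained infima lie in `G`, so their difference does; for two unattained ones this is
equality in the quotient. The mixed cases are excluded because the adjoined 0 is not a class of ℝ/G.
-/
theorem eq_singleton_add_of_infClass_eq (hS : IsCut G S) (hT : IsCut G T)
    (h : infClass G S = infClass G T) :
    sInf T - sInf S ∈ G ∧ T = {sInf T - sInf S} + S := by
  by_cases h1 : sInf S ∈ S <;> by_cases h2 : sInf T ∈ T
  · have := G.sub_mem (hT.subset h2) (hS.subset h1)
    exact ⟨this, eq_singleton_add hS hT this (by tauto)⟩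
  · rw [infClass_of_mem h1, infClass_of_notMem h2] at h
    exact absurd h.symm WithZero.coe_ne_zero
  · rw [infClass_of_notMem h1, infClass_of_mem h2] at h
    exact absurd h WithZero.coe_ne_zero
  · rw [infClass_of_notMem h1, infClass_of_notMem h2, WithZero.coe_inj, QuotientAddGroup.eq] at h
    have : sInf T - sInf S ∈ G := by
      convert h using 1
      ring
    exact ⟨this, eq_singleton_add hS hT this (by tauto)⟩

theorem dense_of_ne_closure (h : (G : Set ℝ) ≠ closure (G : Set ℝ)) : Dense (G : Set ℝ) := by
  rcases G.dense_or_cyclic with h' | ⟨a, ha⟩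
  · exact h'
  · refine absurd (IsClosed.closure_eq ?_).symm h
    rw [ha, ← AddSubgroup.zmultiples_eq_closure]
    exact AddSubgroup.isClosed_of_discrete

theorem IsCut.sInf_mem (hS : IsCut G S) (h : ¬ Dense (G : Set ℝ)) : sInf S ∈ S := by
  by_contra hc
  -- An unattained infimum is approached by a strictly decreasing pair in `S` within any ε; their
  -- difference is a small positive element of `G`.
  refine h (G.dense_of_not_isolated_zero fun ε hε => ?_)
  obtain ⟨s, hs, hs'⟩ := exists_lt_of_csInf_lt hS.nonempty (show sInf S < sInf S + ε by linarith)
  have h1 : sInf S < s := lt_of_le_of_ne (csInf_le hS.bddBelow hs) (by rintro e; exact hc (e ▸ hs))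
  obtain ⟨t, ht, ht'⟩ := exists_lt_of_csInf_lt hS.nonempty h1
  have h2 := csInf_le hS.bddBelow ht
  exact ⟨s - t, G.sub_mem (hS.subset hs) (hS.subset ht), by linarith, by linarith⟩

theorem isLeast_Ici_inter {a : ℝ} (ha : a ∈ G) : IsLeast (Set.Ici a ∩ (G : Set ℝ)) a :=
  ⟨⟨le_refl a, ha⟩, fun _ h => h.1⟩

/-- Split `g` as `a + (g - a)`; only one of the two endpoints has to lie in `G`. -/
theorem Ici_inter_add_Ici_inter {a b : ℝ} (ha : a ∈ G) :
    (Set.Ici a ∩ (G : Set ℝ)) + (Set.Ici b ∩ (G : Set ℝ)) = Set.Ici (a + b) ∩ (G : Set ℝ) := by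
  ext g
  constructor
  · rintro ⟨x, ⟨hx, hx'⟩, y, ⟨hy, hy'⟩, rfl⟩
    exact ⟨Set.mem_Ici.2 (add_le_add hx hy), G.add_mem hx' hy'⟩
  · rintro ⟨h, hg⟩
    have h : a + b ≤ g := h
    refine ⟨a, ⟨le_refl a, ha⟩, g - a, ⟨?_, G.sub_mem hg ha⟩, by simp⟩
    change b ≤ g - a
    linarith

theorem IsCut.Ici_inter_add (hS : IsCut G S) {a : ℝ} (ha : a ∈ G) :
    (Set.Ici a ∩ (G : Set ℝ)) + S = {a} + S := by
  ext g
  rw [Set.singleton_add, Set.mem_image]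
  constructor
  · rintro ⟨x, ⟨hx, hx'⟩, s, hs, rfl⟩
    have hx : a ≤ x := hx
    refine ⟨x + s - a, ?_, by ring⟩
    exact hS.upper s hs _ (G.sub_mem (G.add_mem hx' (hS.subset hs)) ha) (by linarith)
  · rintro ⟨s, hs, rfl⟩
    exact Set.add_mem_add ⟨le_refl a, ha⟩ hs

/-- Density makes `r` the infimum, and the open ray keeps it unattained even when `r ∈ G`. -/
theorem infClass_Ioi_inter (hG : Dense (G : Set ℝ)) (r : ℝ) :
    infClass G (Set.Ioi r ∩ (G : Set ℝ)) = ((QuotientAddGroup.mk r : ℝ ⧸ G) : WithZero _) := by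
  have hinf : sInf (Set.Ioi r ∩ (G : Set ℝ)) = r := by
    refine csInf_eq_of_forall_ge_of_forall_gt_exists_lt ?_ (fun a ha => le_of_lt ha.1) ?_
    · obtain ⟨g, hg, hg', -⟩ := hG.exists_between (lt_add_one r)
      exact ⟨g, hg', hg⟩
    · intro w hw
      obtain ⟨g, hg, hg', hg''⟩ := hG.exists_between hw
      exact ⟨g, ⟨hg', hg⟩, hg''⟩
  rw [infClass_of_notMem, hinf]
  rw [hinf]
  exact fun h => lt_irrefl r h.1

end Cuts

/-! ### Commutative monoids -/

section

theorem Reg_map_mem {M M' : Type*} [CommMonoid M] [CommMonoid M'] (f : M →* M') {a : M}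
    (ha : a ∈ Reg M) : f a ∈ Reg M' := by
  obtain ⟨b, hb⟩ := ha
  exact ⟨f b, by rw [← map_mul, ← map_mul, ← hb]⟩

theorem withZero_mem_Reg {A : Type*} [AddCommGroup A] (x : WithZero A) :
    Multiplicative.ofAdd x ∈ Reg (Multiplicative (WithZero A)) := by
  induction x with
  | zero => exact (Reg _).one_mem
  | coe a =>
    refine ⟨Multiplicative.ofAdd ((-a : A) : WithZero A), ?_⟩
    rw [← ofAdd_add, ← ofAdd_add, ← WithZero.coe_add, ← WithZero.coe_add]
    simp

theorem directSum_mem_Reg {ι : Type*} {β : ι → Type*} [∀ i, AddCommMonoid (β i)]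
    (h : ∀ i (x : β i), Multiplicative.ofAdd x ∈ Reg (Multiplicative (β i))) (x : ⨁ i, β i) :
    Multiplicative.ofAdd x ∈ Reg (Multiplicative (⨁ i, β i)) := by
  classical
  induction x using DirectSum.induction_on with
  | zero => exact (Reg _).one_mem
  | of i x => exact Reg_map_mem (AddMonoidHom.toMultiplicative (DirectSum.of β i)) (h i x)
  | add x y hx hy => exact (Reg _).mul_mem hx hy

/-- Finiteness of the support on the sigma type bounds both levels of the sum at once, so currying a
finitely supported function suffices. -/
theorem exists_directSum_apply_eq {ι : Type*} {α : ι → Type*} {δ : ι → Type*}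
    [∀ i, AddCommMonoid (δ i)] (f : ∀ i, α i → δ i)
    (hf : {k : Σ i, α i | f k.1 k.2 ≠ 0}.Finite) :
    ∃ d : ⨁ i, ⨁ _ : α i, δ i, ∀ i j, d i j = f i j := by
  classical
  refine ⟨DirectSum.sigmaCurry (δ := fun i (_ : α i) => δ i)
    (DFinsupp.mk hf.toFinset fun k => f k.1.1 k.1.2), fun i j => ?_⟩
  rw [DirectSum.sigmaCurry_apply]
  erw [DFinsupp.mk_apply]
  split_ifs with h
  · rfl
  · by_contra hc
    exact h (hf.mem_toFinset.2 (Ne.symm hc))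

theorem directSum_mem_of_forall {ι : Type*} [DecidableEq ι] {α : ι → Type*}
    [∀ i, DecidableEq (α i)] {δ : ι → Type*} [∀ i, AddCommMonoid (δ i)]
    (N : AddSubmonoid (⨁ i, ⨁ _ : α i, δ i))
    (h : ∀ i j x, DirectSum.of (fun i => ⨁ _ : α i, δ i) i (DirectSum.of (fun _ => δ i) j x) ∈ N)
    (d : ⨁ i, ⨁ _ : α i, δ i) : d ∈ N := by
  induction d using DirectSum.induction_on with
  | zero => exact N.zero_mem
  | of i x =>
    induction x using DirectSum.induction_on with
    | zero => rw [map_zero]; exact N.zero_mem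
    | of j x => exact h i j x
    | add x y hx hy => rw [map_add]; exact N.add_mem hx hy
  | add x y hx hy => exact N.add_mem hx hy

theorem directSum_of_of_apply {ι : Type*} [DecidableEq ι] {α : ι → Type*}
    [∀ i, DecidableEq (α i)] {δ : ι → Type*} [∀ i, AddCommMonoid (δ i)] (i : ι) (j : α i)
    (x : δ i) (d : ⨁ i, ⨁ _ : α i, δ i) (h : d i j = x)
    (h' : ∀ i' (j' : α i'), (⟨i', j'⟩ : Σ i, α i) ≠ ⟨i, j⟩ → d i' j' = 0) :
    DirectSum.of (fun i => ⨁ _ : α i, δ i) i (DirectSum.of (fun _ => δ i) j x) = d := by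
  refine DFinsupp.ext fun i' => DFinsupp.ext fun j' => ?_
  by_cases hk : (⟨i', j'⟩ : Σ i, α i) = ⟨i, j⟩
  · cases hk
    rw [DirectSum.of_eq_same, DirectSum.of_eq_same, h]
  · rw [h' i' j' hk]
    by_cases hi : i' = i
    · subst hi
      rw [DirectSum.of_eq_same]
      refine DirectSum.of_eq_of_ne _ _ _ fun e => hk ?_
      rw [e]
    · rw [DirectSum.of_eq_of_ne _ _ _ hi]
      rfl

/-- If a surjective homomorphism `f : M →* T` identifies two elements exactly if they differ by
units, then it induces an isomorphism from `Reg (M / N) / (Mˣ / N)` to `T`. -/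
theorem exists_regQuot_mulEquiv {M T : Type*} [CommMonoid M] [CommMonoid T] (N : Submonoid M)
    (f : M →* T) (hsurj : Function.Surjective f) (hN : ∀ a ∈ N, f a = 1)
    (hunit : ∀ a ∈ IsUnit.submonoid M, f a = 1)
    (hinj : ∀ a b, f a = f b → ∃ m ∈ IsUnit.submonoid M, ∃ n ∈ IsUnit.submonoid M, m * a = n * b)
    (hT : ∀ x : T, x ∈ Reg T) :
    ∃ e : MonQuot (((IsUnit.submonoid M).map (quotCon N).mk').comap
        (Reg (MonQuot N)).subtype) ≃* T,
      ∀ (a : M) (h : (quotCon N).mk' a ∈ Reg (MonQuot N)), e ((quotCon _).mk' ⟨_, h⟩) = f a := by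
  let g : MonQuot N →* T := (quotCon N).lift f (by
    rintro a b ⟨m, hm, n, hn, e⟩
    change f a = f b
    simpa [hN m hm, hN n hn] using congrArg f e)
  let G : MonQuot (((IsUnit.submonoid M).map (quotCon N).mk').comap
        (Reg (MonQuot N)).subtype) →* T :=
    (quotCon _).lift (g.comp (Reg (MonQuot N)).subtype) (by
      rintro ⟨a, ha⟩ ⟨b, hb⟩ ⟨⟨_, _⟩, ⟨m, hm, rfl⟩, ⟨_, _⟩, ⟨n, hn, rfl⟩, e⟩
      have e := congrArg (fun z => g z.1) e
      change g ((quotCon N).mk' m * a) = g ((quotCon N).mk' n * b) at e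
      rw [map_mul, map_mul] at e
      change f m * g a = f n * g b at e
      rw [hunit m hm, hunit n hn, one_mul, one_mul] at e
      exact e)
  -- Regularity lifts from `T`: if `f a = f (a * b * a)`, the two arguments differ by units `u` and
  -- `n`, and `b * (u⁻¹ * n)` is a pseudo-inverse of `a` already in `M`.
  have hreg : ∀ a : M, (quotCon N).mk' a ∈ Reg (MonQuot N) := by
    intro a
    obtain ⟨y, hy⟩ := hT (f a)
    obtain ⟨b, rfl⟩ := hsurj y
    rw [← map_mul, ← map_mul] at hy
    obtain ⟨m, ⟨u, rfl⟩, n, hn, e⟩ := hinj _ _ hy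
    refine Reg_map_mem _ ⟨b * (↑u⁻¹ * n), ?_⟩
    calc a = ↑u⁻¹ * (↑u * a) := by simp
      _ = ↑u⁻¹ * (n * (a * b * a)) := by rw [e]
      _ = _ := by ac_rfl
  refine ⟨MulEquiv.ofBijective G ⟨?_, ?_⟩, fun a h => rfl⟩
  · intro x y hxy
    induction x using Con.induction_on with | _ x =>
    induction y using Con.induction_on with | _ y =>
    obtain ⟨x, hx⟩ := x
    obtain ⟨y, hy⟩ := y
    induction x using Con.induction_on with | _ x =>
    induction y using Con.induction_on with | _ y =>
    obtain ⟨m, hm, n, hn, e⟩ := hinj x y hxy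
    refine (Con.eq _).2 ⟨⟨(quotCon N).mk' m, hreg m⟩, ⟨m, hm, rfl⟩,
      ⟨(quotCon N).mk' n, hreg n⟩, ⟨n, hn, rfl⟩, Subtype.ext ?_⟩
    exact congrArg (quotCon N).mk' e
  · intro x
    obtain ⟨a, rfl⟩ := hsurj x
    exact ⟨(quotCon _).mk' ⟨_, hreg a⟩, rfl⟩

end

/-! ### Values of the normalized valuations -/

section Values

variable {𝔬 K L : Type*} [CommRing 𝔬] [IsDedekindDomain 𝔬] [Field K] [Algebra 𝔬 K]
  [IsFractionRing 𝔬 K] [Field L] [Algebra K L] [Algebra 𝔬 L] [IsScalarTower 𝔬 K L]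
  [IsGalois K L]

variable (K) in
/-- The real number `v_𝔓(x)`. -/
noncomputable def realVal (ho : ¬ IsField 𝔬) (P : MaximalSpectrum (integralClosure 𝔬 L))
    (x : Lˣ) : ℝ :=
  normVal K ho P (Additive.ofMul x)

variable (ho : ¬ IsField 𝔬) (P Q : MaximalSpectrum (integralClosure 𝔬 L))

theorem realVal_mul (x y : Lˣ) : realVal K ho P (x * y) = realVal K ho P x + realVal K ho P y := by
  simp [realVal]

theorem realVal_one : realVal K ho P 1 = 0 := by
  simp [realVal]

theorem realVal_inv (x : Lˣ) : realVal K ho P x⁻¹ = - realVal K ho P x := by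
  simp [realVal]

theorem realVal_pow (x : Lˣ) (n : ℕ) : realVal K ho P (x ^ n) = n * realVal K ho P x := by
  simp [realVal]

theorem min_le_realVal_add {x y z : Lˣ} (h : (x : L) + y = z) :
    min (realVal K ho P x) (realVal K ho P y) ≤ realVal K ho P z := by
  have := (normVal_spec K ho P).min_le_add x y z h
  unfold realVal
  exact_mod_cast this

theorem realVal_nonneg_iff {x : Lˣ} : 0 ≤ realVal K ho P x ↔ MemLocAt P (x : L) := by
  rw [← (normVal_spec K ho P).nonneg_iff]
  exact Rat.cast_nonneg

theorem realVal_mem (x : Lˣ) : realVal K ho P x ∈ valGroup K ho P :=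
  ⟨Additive.ofMul x, rfl⟩

theorem exists_realVal_eq {g : ℝ} (hg : g ∈ valGroup K ho P) : ∃ x : Lˣ, realVal K ho P x = g := by
  obtain ⟨x, hx⟩ := hg
  exact ⟨x.toMul, hx⟩

theorem realVal_nonneg {x : Lˣ} (hx : (x : L) ∈ integralClosure 𝔬 L) : 0 ≤ realVal K ho P x := by
  rw [realVal_nonneg_iff]
  refine ⟨⟨x, hx⟩, 1, fun h => P.isMaximal.ne_top ((Ideal.eq_top_iff_one _).2 h), by simp⟩

/-- The value is at most 0 exactly when `x⁻¹` lies in the localization at `P`, and for integral `x`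
this means `x ∉ P`. -/
theorem realVal_pos_iff {x : Lˣ} (hx : (x : L) ∈ integralClosure 𝔬 L) :
    0 < realVal K ho P x ↔ (⟨x, hx⟩ : integralClosure 𝔬 L) ∈ P.asIdeal := by
  rw [← not_le, ← not_iff_not, not_not, ← neg_nonneg, ← realVal_inv, realVal_nonneg_iff]
  constructor
  · rintro ⟨a, s, hs, h⟩ hx'
    refine hs ?_
    have : s = a * ⟨x, hx⟩ := by
      apply Subtype.ext
      push_cast
      rw [← h, Units.val_inv_eq_inv_val]
      field_simp
    rw [this]
    exact P.asIdeal.mul_mem_left _ hx'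
  · intro h
    exact ⟨1, _, h, by simp⟩

theorem realVal_eq_zero_iff {x : Lˣ} (hx : (x : L) ∈ integralClosure 𝔬 L) :
    realVal K ho P x = 0 ↔ (⟨x, hx⟩ : integralClosure 𝔬 L) ∉ P.asIdeal := by
  rw [← realVal_pos_iff (K := K) ho P hx]
  have := realVal_nonneg (K := K) ho P hx
  constructor
  · intro h; rw [h]; exact lt_irrefl 0
  · intro h; linarith

/-- `x / y` is in `𝔒_𝔓` if `v_𝔓(y) ≤ v_𝔓(x)`. -/
theorem exists_mul_eq_of_realVal_le {x y : Lˣ} (h : realVal K ho P y ≤ realVal K ho P x) :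
    ∃ a s : integralClosure 𝔬 L, s ∉ P.asIdeal ∧ (s : L) * x = a * y := by
  have : 0 ≤ realVal K ho P (x * y⁻¹) := by
    rw [realVal_mul, realVal_inv]
    linarith
  obtain ⟨a, s, hs, e⟩ := (realVal_nonneg_iff ho P).1 this
  refine ⟨a, s, hs, ?_⟩
  rw [← e]
  push_cast
  field_simp

theorem ne_zero_of_notMem {P : MaximalSpectrum (integralClosure 𝔬 L)} {s : integralClosure 𝔬 L}
    (hs : s ∉ P.asIdeal) : (s : L) ≠ 0 := by
  intro h
  have : s = 0 := Subtype.ext h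
  exact hs (this ▸ P.asIdeal.zero_mem)

theorem isFractionRing_integralClosure (𝔬 K L : Type*) [CommRing 𝔬] [IsDomain 𝔬] [Field K] [Algebra 𝔬 K]
    [IsFractionRing 𝔬 K] [Field L] [Algebra K L] [Algebra 𝔬 L] [IsScalarTower 𝔬 K L]
    [Algebra.IsAlgebraic K L] :
    IsFractionRing (integralClosure 𝔬 L) L := by
  have : Algebra.IsAlgebraic 𝔬 L := (IsFractionRing.comap_isAlgebraic_iff (K := K)).2
    (inferInstance : Algebra.IsAlgebraic K L)
  refine integralClosure.isFractionRing_of_algebraic fun x hx => ?_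
  rw [IsScalarTower.algebraMap_apply 𝔬 K L] at hx
  simpa using hx

theorem exists_mul_mem (𝔬 K L : Type*) [CommRing 𝔬] [IsDomain 𝔬] [Field K] [Algebra 𝔬 K]
    [IsFractionRing 𝔬 K] [Field L] [Algebra K L] [Algebra 𝔬 L] [IsScalarTower 𝔬 K L]
    [Algebra.IsAlgebraic K L]
    (x : Lˣ) : ∃ s : Lˣ, (s : L) ∈ integralClosure 𝔬 L ∧
    ((x * s : Lˣ) : L) ∈ integralClosure 𝔬 L := by
  have := isFractionRing_integralClosure 𝔬 K L
  obtain ⟨⟨a, s⟩, h⟩ := IsLocalization.surj (integralClosure 𝔬 L)⁰ (x : L)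
  have hs : ((s : integralClosure 𝔬 L) : L) ≠ 0 := fun h0 =>
    nonZeroDivisors.ne_zero s.2 (Subtype.ext h0)
  refine ⟨Units.mk0 _ hs, s.1.2, ?_⟩
  rw [Units.val_mul, Units.val_mk0]
  have h : (x : L) * ((s : integralClosure 𝔬 L) : L) = a := h
  rw [h]
  exact a.2

/-! ### Approximation by integral elements -/

/-- The normalization supplies an element of `K` of value 1; clearing its denominator cannot lower
the value. -/
theorem exists_integral_one_le_realVal :
    ∃ x : Lˣ, (x : L) ∈ integralClosure 𝔬 L ∧ 1 ≤ realVal K ho P x := by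
  obtain ⟨k, hk⟩ := ((normVal_spec K ho P).map_base 1).2 ⟨1, by simp⟩
  obtain ⟨s, hs, hks⟩ := exists_mul_mem 𝔬 K L (Units.map (algebraMap K L : K →* L) k)
  refine ⟨_, hks, ?_⟩
  rw [realVal_mul]
  have := realVal_nonneg (K := K) ho P hs
  have h1 : realVal K ho P (Units.map (algebraMap K L : K →* L) k) = 1 := by
    rw [realVal, hk]; simp
  linarith

theorem exists_integral_le_realVal (n : ℝ) :
    ∃ x : Lˣ, (x : L) ∈ integralClosure 𝔬 L ∧ n ≤ realVal K ho P x := by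
  obtain ⟨x, hx, h⟩ := exists_integral_one_le_realVal (K := K) ho P
  obtain ⟨m, hm⟩ := exists_nat_ge n
  refine ⟨x ^ m, ?_, ?_⟩
  · rw [Units.val_pow_eq_pow_val]; exact pow_mem hx m
  · rw [realVal_pow]
    nlinarith [(Nat.cast_nonneg m : (0 : ℝ) ≤ m)]

/-- Distinct maximal ideals are incomparable: a power of an element of `P` outside `Q` has large
value at `P` and value 0 at `Q`. -/
theorem exists_le_realVal_and_eq_zero (hPQ : P ≠ Q) (n : ℝ) :
    ∃ x : Lˣ, (x : L) ∈ integralClosure 𝔬 L ∧ n ≤ realVal K ho P x ∧ realVal K ho Q x = 0 := by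
  have : ∃ a ∈ P.asIdeal, a ∉ Q.asIdeal := by
    by_contra! hc
    exact hPQ (MaximalSpectrum.ext (P.isMaximal.eq_of_le Q.isMaximal.ne_top hc))
  obtain ⟨a, haP, haQ⟩ := this
  let x := Units.mk0 (a : L) (ne_zero_of_notMem haQ)
  have hx : 0 < realVal K ho P x := (realVal_pos_iff ho P a.2).2 haP
  have hx' : realVal K ho Q x = 0 := (realVal_eq_zero_iff ho Q a.2).2 haQ
  obtain ⟨m, hm⟩ := exists_nat_ge (n / realVal K ho P x)
  refine ⟨x ^ m, ?_, ?_, ?_⟩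
  · rw [Units.val_pow_eq_pow_val]; exact pow_mem a.2 m
  · rw [realVal_pow]
    exact (div_le_iff₀ hx).1 hm
  · rw [realVal_pow, hx', mul_zero]

theorem finite_realVal_ne_zero (hfin : FiniteCharacter (integralClosure 𝔬 L)) (x : Lˣ) :
    {P | realVal K ho P x ≠ 0}.Finite := by
  have key : ∀ y : Lˣ, (y : L) ∈ integralClosure 𝔬 L → {P | realVal K ho P y ≠ 0}.Finite := by
    intro y hy
    refine (hfin ⟨y, hy⟩ fun h => y.ne_zero (congrArg Subtype.val h)).subset fun P hP => ?_
    by_contra hc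
    exact hP ((realVal_eq_zero_iff ho P hy).2 hc)
  -- Writing `x` as a quotient of integral elements reduces to `key`, where a non-zero value at `P`
  -- means membership in `P`.
  obtain ⟨s, hs, hxs⟩ := exists_mul_mem 𝔬 K L x
  refine ((key s hs).union (key _ hxs)).subset fun P hP => ?_
  by_contra hc
  simp only [Set.mem_union, Set.mem_ofPred_eq, not_or, not_not, realVal_mul] at hc
  rw [hc.1, add_zero] at hc
  exact hP hc.2

theorem exists_finset_le_realVal (s : Finset (MaximalSpectrum (integralClosure 𝔬 L)))
    (f : MaximalSpectrum (integralClosure 𝔬 L) → ℝ) (hs : P ∉ s) :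
    ∃ x : Lˣ, (x : L) ∈ integralClosure 𝔬 L ∧ realVal K ho P x = 0 ∧
      ∀ Q ∈ s, f Q ≤ realVal K ho Q x := by
  classical
  induction s using Finset.induction_on with
  | empty => exact ⟨1, by simp, realVal_one ho P, by simp⟩
  | insert R s hR ih =>
    rw [Finset.mem_insert, not_or] at hs
    obtain ⟨x, hx, hx0, hxs⟩ := ih hs.2
    obtain ⟨y, hy, hyR, hy0⟩ := exists_le_realVal_and_eq_zero (K := K) ho R P (Ne.symm hs.1) (f R)
    refine ⟨x * y, ?_, by rw [realVal_mul, hx0, hy0, add_zero], fun Q hQ => ?_⟩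
    · rw [Units.val_mul]; exact mul_mem hx hy
    · rw [realVal_mul]
      have h1 := realVal_nonneg (K := K) ho Q hx
      have h2 := realVal_nonneg (K := K) ho Q hy
      rcases Finset.mem_insert.1 hQ with rfl | hQ
      · linarith
      · linarith [hxs Q hQ]

/-- Every value of `v_𝔓` is attained at an element that is integral at all other places. -/
theorem exists_realVal_eq_and_nonneg (hfin : FiniteCharacter (integralClosure 𝔬 L)) {g : ℝ}
    (hg : g ∈ valGroup K ho P) :
    ∃ x : Lˣ, realVal K ho P x = g ∧ ∀ Q ≠ P, 0 ≤ realVal K ho Q x := by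
  classical
  obtain ⟨y, rfl⟩ := exists_realVal_eq ho P hg
  -- The factor `z` compensates the negative values of `y` at the finitely many other places
  -- concerned, without changing the value at `P`.
  obtain ⟨z, hz, hz0, hzs⟩ := exists_finset_le_realVal (K := K) ho P
    ((finite_realVal_ne_zero (K := K) ho hfin y).toFinset.erase P)
    (fun Q => - realVal K ho Q y) (Finset.notMem_erase _ _)
  refine ⟨y * z, by rw [realVal_mul, hz0, add_zero], fun Q hQ => ?_⟩
  rw [realVal_mul]
  by_cases h : realVal K ho Q y = 0
  · rw [h, zero_add]; exact realVal_nonneg ho Q hz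
  · have := hzs Q (by simp [hQ, h])
    linarith

/-! ### Values on fractional ideals -/

variable (K) in
/-- The set of values of `v_𝔓` on the non-zero elements of a fractional ideal. -/
def valSet (I : FracMon (integralClosure 𝔬 L) L) : Set ℝ :=
  {g | ∃ x : Lˣ, (x : L) ∈ (I : FractionalIdeal (integralClosure 𝔬 L)⁰ L) ∧ realVal K ho P x = g}

theorem FracMon.exists_unit_mem (I : FracMon (integralClosure 𝔬 L) L) :
    ∃ x : Lˣ, (x : L) ∈ (I : FractionalIdeal (integralClosure 𝔬 L)⁰ L) := by
  by_contra! hc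
  refine I.2 (FractionalIdeal.eq_zero_iff.2 fun x hx => ?_)
  by_contra h0
  exact hc (Units.mk0 x h0) hx

theorem FracMon.exists_denom (I : FracMon (integralClosure 𝔬 L) L) :
    ∃ d : Lˣ, (d : L) ∈ integralClosure 𝔬 L ∧
      ∀ x ∈ (I : FractionalIdeal (integralClosure 𝔬 L)⁰ L), (d : L) * x ∈ integralClosure 𝔬 L := by
  obtain ⟨a, ha, h⟩ := (I : FractionalIdeal (integralClosure 𝔬 L)⁰ L).isFractional
  have ha0 : (a : L) ≠ 0 := fun h0 => nonZeroDivisors.ne_zero ha (Subtype.ext h0)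
  refine ⟨Units.mk0 _ ha0, a.2, fun x hx => ?_⟩
  obtain ⟨r, hr⟩ := h x hx
  have : (a : L) * x = r := hr.symm
  rw [Units.val_mk0, this]
  exact r.2

variable {P} in
theorem exists_unit_smul_mem {I : FractionalIdeal (integralClosure 𝔬 L)⁰ L} {x y : Lˣ}
    (hy : (y : L) ∈ I) (h : realVal K ho P y ≤ realVal K ho P x) :
    ∃ s : integralClosure 𝔬 L, s ∉ P.asIdeal ∧ (s : L) * x ∈ I := by
  obtain ⟨a, s, hs, e⟩ := exists_mul_eq_of_realVal_le ho P h
  refine ⟨s, hs, ?_⟩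
  rw [e]
  exact (I : Submodule (integralClosure 𝔬 L) L).smul_mem a hy

/-- One denominator `d` bounds the values from below at every place simultaneously, which is what
`finite_valSet_ne` exploits. -/
theorem neg_realVal_denom_le {I : FracMon (integralClosure 𝔬 L) L} {d : Lˣ}
    (hd : ∀ x ∈ (I : FractionalIdeal (integralClosure 𝔬 L)⁰ L), (d : L) * x ∈ integralClosure 𝔬 L)
    {g : ℝ} (hg : g ∈ valSet K ho P I) : - realVal K ho P d ≤ g := by
  obtain ⟨x, hx, rfl⟩ := hg
  have := realVal_nonneg (K := K) ho P (x := d * x) (by rw [Units.val_mul]; exact hd x hx)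
  rw [realVal_mul] at this
  linarith

theorem isCut_valSet (I : FracMon (integralClosure 𝔬 L) L) :
    IsCut (valGroup K ho P) (valSet K ho P I) where
  nonempty := by
    obtain ⟨x, hx⟩ := FracMon.exists_unit_mem I
    exact ⟨_, x, hx, rfl⟩
  bddBelow := by
    obtain ⟨d, -, hd⟩ := FracMon.exists_denom I
    exact ⟨_, fun g hg => neg_realVal_denom_le ho P hd hg⟩
  subset := by
    rintro _ ⟨x, -, rfl⟩
    exact realVal_mem ho P x
  upper := by
    rintro _ ⟨x, hx, rfl⟩ g hg h
    obtain ⟨y, rfl⟩ := exists_realVal_eq ho P hg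
    -- The factor `s` lies outside `P`, so it has value 0 and `s * y` has the value of `y`.
    obtain ⟨s, hs, hsy⟩ := exists_unit_smul_mem ho hx h
    refine ⟨Units.mk0 (s : L) (ne_zero_of_notMem hs) * y, by simpa using hsy, ?_⟩
    rw [realVal_mul, (realVal_eq_zero_iff ho P s.2).2 hs, zero_add]

open scoped Pointwise in
theorem valSet_mul (I J : FracMon (integralClosure 𝔬 L) L) :
    valSet K ho P (I * J) = valSet K ho P I + valSet K ho P J := by
  apply Set.Subset.antisymm
  · rintro _ ⟨z, hz, rfl⟩
    -- An inequality is all that survives sums of products; upward closure turns it into an equality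
    -- afterwards. Quantifying over units equal to `z` makes the case `z = 0` vacuous in the
    -- induction.
    have key : ∀ z ∈ (I : FractionalIdeal (integralClosure 𝔬 L)⁰ L) * J, ∀ u : Lˣ, (u : L) = z →
        ∃ a ∈ valSet K ho P I, ∃ b ∈ valSet K ho P J, a + b ≤ realVal K ho P u := by
      intro z hz
      refine FractionalIdeal.mul_induction_on hz ?_ ?_
      · intro x hx y hy u hu
        have hx0 : x ≠ 0 := by rintro rfl; exact u.ne_zero (by rw [hu, zero_mul])
        have hy0 : y ≠ 0 := by rintro rfl; exact u.ne_zero (by rw [hu, mul_zero])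
        refine ⟨_, ⟨Units.mk0 x hx0, hx, rfl⟩, _, ⟨Units.mk0 y hy0, hy, rfl⟩, ?_⟩
        rw [← realVal_mul, show Units.mk0 x hx0 * Units.mk0 y hy0 = u from Units.ext hu.symm]
      · intro x y ihx ihy u hu
        by_cases hx0 : x = 0
        · exact ihy u (by rw [hu, hx0, zero_add])
        by_cases hy0 : y = 0
        · exact ihx u (by rw [hu, hy0, add_zero])
        have hmin := min_le_realVal_add (K := K) ho P (x := Units.mk0 x hx0)
          (y := Units.mk0 y hy0) (z := u) hu.symm
        rcases min_le_iff.1 hmin with h | h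
        · obtain ⟨a, ha, b, hb, hab⟩ := ihx (Units.mk0 x hx0) rfl
          exact ⟨a, ha, b, hb, hab.trans h⟩
        · obtain ⟨a, ha, b, hb, hab⟩ := ihy (Units.mk0 y hy0) rfl
          exact ⟨a, ha, b, hb, hab.trans h⟩
    obtain ⟨a, ha, b, hb, h⟩ := key z hz z rfl
    have haG := (isCut_valSet ho P I).subset ha
    refine ⟨a, ha, realVal K ho P z - a, ?_, by simp⟩
    exact (isCut_valSet ho P J).upper b hb _ (sub_mem (realVal_mem ho P z) haG) (by linarith)
  · rintro _ ⟨_, ⟨x, hx, rfl⟩, _, ⟨y, hy, rfl⟩, rfl⟩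
    refine ⟨x * y, ?_, realVal_mul ho P x y⟩
    rw [Units.val_mul]
    exact FractionalIdeal.mul_mem_mul hx hy

/-! ### Fractional ideals are determined by their value sets -/

/-- The ideal `N` of all `r` with `r x ∈ I` is contained in no maximal ideal `m`: the hypothesis at
`m` yields a multiplier outside `m`. -/
theorem mem_of_forall_exists_realVal_le {I : FractionalIdeal (integralClosure 𝔬 L)⁰ L} {x : Lˣ}
    (h : ∀ P, ∃ y : Lˣ, (y : L) ∈ I ∧ realVal K ho P y ≤ realVal K ho P x) : (x : L) ∈ I := by
  let N : Ideal (integralClosure 𝔬 L) :=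
    (I : Submodule (integralClosure 𝔬 L) L).comap (LinearMap.toSpanSingleton _ L (x : L))
  have hN : N = ⊤ := by
    by_contra hN
    obtain ⟨m, hm, hNm⟩ := Ideal.exists_le_maximal N hN
    obtain ⟨y, hy, e⟩ := h ⟨m, hm⟩
    obtain ⟨s, hs, hsx⟩ := exists_unit_smul_mem ho hy e
    exact hs (hNm hsx)
  have : (1 : integralClosure 𝔬 L) • (x : L) ∈ I := (Ideal.eq_top_iff_one N).1 hN
  rwa [one_smul] at this

theorem le_of_forall_valSet_subset {I J : FracMon (integralClosure 𝔬 L) L}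
    (h : ∀ P, valSet K ho P I ⊆ valSet K ho P J) :
    (I : FractionalIdeal (integralClosure 𝔬 L)⁰ L) ≤ J := by
  intro x hx
  by_cases hx0 : x = 0
  · rw [hx0]; exact (_ : Submodule (integralClosure 𝔬 L) L).zero_mem
  refine mem_of_forall_exists_realVal_le (K := K) ho (x := Units.mk0 x hx0) fun P => ?_
  obtain ⟨y, hy, e⟩ := h P ⟨Units.mk0 x hx0, hx, rfl⟩
  exact ⟨y, hy, e.le⟩

theorem eq_of_forall_valSet_eq {I J : FracMon (integralClosure 𝔬 L) L}
    (h : ∀ P, valSet K ho P I = valSet K ho P J) : I = J :=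
  Subtype.ext (le_antisymm (le_of_forall_valSet_subset ho fun P => (h P).subset)
    (le_of_forall_valSet_subset ho fun P => (h P).superset))

theorem valSet_eq_Ici {I : FracMon (integralClosure 𝔬 L) L} {g : ℝ}
    (h : IsLeast (valSet K ho P I) g) : valSet K ho P I = Set.Ici g ∩ valGroup K ho P := by
  have hI := isCut_valSet (K := K) ho P I
  ext a
  exact ⟨fun ha => ⟨h.2 ha, hI.subset ha⟩, fun ⟨h1, h2⟩ => hI.upper g h.1 a h2 h1⟩

theorem valSet_one :
    valSet K ho P (1 : FracMon (integralClosure 𝔬 L) L) = Set.Ici 0 ∩ valGroup K ho P := by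
  refine valSet_eq_Ici ho P ⟨⟨1, ?_, realVal_one ho P⟩, ?_⟩
  · exact FractionalIdeal.one_mem_one _
  · rintro _ ⟨x, hx, rfl⟩
    obtain ⟨r, hr⟩ := (FractionalIdeal.mem_one_iff _).1 hx
    exact realVal_nonneg ho P (hr ▸ r.2)

/-- Take a non-zero `x ∈ I` and a denominator `d` of `I`. Wherever both have value 0, the least
value on `I` is 0. -/
theorem finite_valSet_ne (hfin : FiniteCharacter (integralClosure 𝔬 L))
    (I : FracMon (integralClosure 𝔬 L) L) :
    {P | valSet K ho P I ≠ Set.Ici 0 ∩ valGroup K ho P}.Finite := by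
  obtain ⟨x, hx⟩ := FracMon.exists_unit_mem I
  obtain ⟨d, -, hd⟩ := FracMon.exists_denom I
  refine ((finite_realVal_ne_zero (K := K) ho hfin x).union
    (finite_realVal_ne_zero (K := K) ho hfin d)).subset fun P hP => ?_
  by_contra hc
  simp only [Set.mem_union, Set.mem_ofPred_eq, not_or, not_not] at hc
  refine hP (valSet_eq_Ici ho P ⟨⟨x, hx, hc.1⟩, fun g hg => ?_⟩)
  have := neg_realVal_denom_le ho P hd hg
  rwa [hc.2, neg_zero] at this

theorem isLeast_valSet_of_mem_PrincMon {I : FracMon (integralClosure 𝔬 L) L}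
    (hI : I ∈ PrincMon (integralClosure 𝔬 L) L) : ∃ g, IsLeast (valSet K ho P I) g := by
  obtain ⟨a, ha, h⟩ := hI
  refine ⟨realVal K ho P (Units.mk0 a ha), ⟨_, (h a).2 ⟨1, by simp⟩, rfl⟩, ?_⟩
  rintro _ ⟨x, hx, rfl⟩
  obtain ⟨r, hr⟩ := (h x).1 hx
  have hr0 : algebraMap (integralClosure 𝔬 L) L r ≠ 0 := by
    intro h0
    exact x.ne_zero (by rw [← hr, h0, zero_mul])
  have e : x = Units.mk0 _ hr0 * Units.mk0 a ha := Units.ext hr.symm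
  rw [e, realVal_mul]
  have := realVal_nonneg (K := K) ho P (x := Units.mk0 _ hr0) r.2
  linarith

/-! ### Fractional ideals prescribed by a cut at one place -/

variable (K) in
/-- The fractional ideal of all elements with `v_𝔓`-value in the upper set `C`, that are integral
at all other places. -/
def cutIdeal (C : Set ℝ) (hC : IsUpperSet C) (hb : BddBelow C) (hn : C.Nonempty) :
    FracMon (integralClosure 𝔬 L) L where
  -- Testing only units equal to `x` lets 0 belong to the ideal vacuously.
  val := ⟨{ carrier := {x | ∀ u : Lˣ, (u : L) = x →
              realVal K ho P u ∈ C ∧ ∀ Q ≠ P, 0 ≤ realVal K ho Q u}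
            add_mem' := by
              intro x y hx hy u hu
              by_cases hx0 : x = 0
              · exact hy u (by rw [hu, hx0, zero_add])
              by_cases hy0 : y = 0
              · exact hx u (by rw [hu, hy0, add_zero])
              have hx := hx (Units.mk0 x hx0) rfl
              have hy := hy (Units.mk0 y hy0) rfl
              have hmin := fun Q => min_le_realVal_add (K := K) ho Q (x := Units.mk0 x hx0)
                (y := Units.mk0 y hy0) (z := u) hu.symm
              refine ⟨?_, fun Q hQ => (le_min (hx.2 Q hQ) (hy.2 Q hQ)).trans (hmin Q)⟩
              rcases min_le_iff.1 (hmin P) with h | h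
              · exact hC h hx.1
              · exact hC h hy.1
            zero_mem' := fun u hu => absurd hu u.ne_zero
            smul_mem' := by
              intro r x hx u hu
              have hr0 : (r : L) ≠ 0 := by
                intro h
                refine u.ne_zero ?_
                rw [hu, Algebra.smul_def]
                change (r : L) * x = 0
                rw [h, zero_mul]
              have e : u = Units.mk0 (r : L) hr0 * (Units.mk0 (r : L) hr0)⁻¹ * u := by simp
              have hx := hx ((Units.mk0 (r : L) hr0)⁻¹ * u) (by
                rw [Units.val_mul, hu, Units.val_inv_eq_inv_val, Units.val_mk0]
                change (r : L)⁻¹ * ((r : L) * x) = x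
                field_simp)
              have hr := fun Q => realVal_nonneg (K := K) ho Q (x := Units.mk0 (r : L) hr0) r.2
              rw [e, mul_assoc]
              simp only [realVal_mul _ _ (Units.mk0 (r : L) hr0)]
              exact ⟨hC (by linarith [hr P]) hx.1, fun Q hQ => add_nonneg (hr Q) (hx.2 Q hQ)⟩ },
    by
      obtain ⟨b, hb⟩ := hb
      -- With `b` a lower bound of `C`, an integral `d` of value at least `-b` makes every product
      -- `d x` non-negative at all places, hence integral.
      obtain ⟨d, hd, hbd⟩ := exists_integral_le_realVal (K := K) ho P (-b)
      refine ⟨⟨d, hd⟩, ?_, fun x hx => ?_⟩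
      · rw [mem_nonZeroDivisors_iff_ne_zero]
        exact fun h => d.ne_zero (congrArg Subtype.val h)
      · by_cases hx0 : x = 0
        · exact ⟨0, by simp [hx0]⟩
        have hx := hx (Units.mk0 x hx0) rfl
        have h : ∀ Q, 0 ≤ realVal K ho Q (d * Units.mk0 x hx0) := by
          intro Q
          rw [realVal_mul]
          by_cases hQ : Q = P
          · have := hb hx.1
            rw [hQ]
            linarith
          · exact add_nonneg (realVal_nonneg ho Q hd) (hx.2 Q hQ)
        have h1 : ((d * Units.mk0 x hx0 : Lˣ) : L) ∈ (1 : FractionalIdeal (integralClosure 𝔬 L)⁰ L) :=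
          mem_of_forall_exists_realVal_le (K := K) ho fun Q =>
            ⟨1, FractionalIdeal.one_mem_one _, by rw [realVal_one]; exact h Q⟩
        exact (FractionalIdeal.mem_one_iff _).1 h1⟩
  property := by
    obtain ⟨c, hc⟩ := hn
    obtain ⟨x, hx, hxc⟩ := exists_integral_le_realVal (K := K) ho P c
    intro h0
    refine x.ne_zero (FractionalIdeal.eq_zero_iff.1 h0 x fun u hu => ?_)
    rw [Units.ext hu]
    exact ⟨hC hxc hc, fun Q _ => realVal_nonneg ho Q hx⟩

variable {C : Set ℝ} {hC : IsUpperSet C} {hb : BddBelow C} {hn : C.Nonempty}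

theorem mem_cutIdeal {x : Lˣ} :
    (x : L) ∈ (cutIdeal K ho P C hC hb hn : FractionalIdeal (integralClosure 𝔬 L)⁰ L) ↔
      realVal K ho P x ∈ C ∧ ∀ Q ≠ P, 0 ≤ realVal K ho Q x :=
  ⟨fun h => h x rfl, fun h u hu => by rwa [Units.ext hu]⟩

/-- Finite character enters here: each value in the cut must be attained by an element that is
integral at all other places. -/
theorem valSet_cutIdeal (hfin : FiniteCharacter (integralClosure 𝔬 L)) :
    valSet K ho P (cutIdeal K ho P C hC hb hn) = C ∩ valGroup K ho P := by
  ext g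
  constructor
  · rintro ⟨x, hx, rfl⟩
    exact ⟨((mem_cutIdeal ho P).1 hx).1, realVal_mem ho P x⟩
  · rintro ⟨hg, hg'⟩
    obtain ⟨x, rfl, hx⟩ := exists_realVal_eq_and_nonneg ho P hfin hg'
    exact ⟨x, (mem_cutIdeal ho P).2 ⟨hg, hx⟩, rfl⟩

variable {P Q} in
theorem valSet_cutIdeal_of_ne (hPQ : P ≠ Q) :
    valSet K ho Q (cutIdeal K ho P C hC hb hn) = Set.Ici 0 ∩ valGroup K ho Q := by
  obtain ⟨c, hc⟩ := hn
  obtain ⟨x, hx, hxP, hxQ⟩ := exists_le_realVal_and_eq_zero (K := K) ho P Q hPQ c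
  refine valSet_eq_Ici ho Q ⟨⟨x, (mem_cutIdeal ho P).2 ⟨hC hxP hc, fun R _ =>
    realVal_nonneg ho R hx⟩, hxQ⟩, ?_⟩
  rintro _ ⟨y, hy, rfl⟩
  exact ((mem_cutIdeal ho P).1 hy).2 Q hPQ.symm

variable (K) in
/-- The ideal `{x | v_𝔓(x) ≥ g, v_𝔔(x) ≥ 0 for 𝔔 ≠ 𝔓}`. -/
noncomputable def closedCutIdeal (g : ℝ) : FracMon (integralClosure 𝔬 L) L :=
  cutIdeal K ho P (Set.Ici g) (isUpperSet_Ici g) bddBelow_Ici Set.nonempty_Ici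

open Classical in
theorem valSet_closedCutIdeal (hfin : FiniteCharacter (integralClosure 𝔬 L)) (g : ℝ) :
    valSet K ho Q (closedCutIdeal K ho P g) =
      Set.Ici (if Q = P then g else 0) ∩ valGroup K ho Q := by
  split_ifs with h
  · subst h
    exact valSet_cutIdeal ho Q hfin
  · exact valSet_cutIdeal_of_ne ho (Ne.symm h)

/-- The inverse is the ideal for `-g`. Since `g` is an actual value, the two cuts at `P` add up to
the trivial one. -/
theorem isUnit_closedCutIdeal (hfin : FiniteCharacter (integralClosure 𝔬 L)) {g : ℝ}
    (hg : g ∈ valGroup K ho P) : IsUnit (closedCutIdeal K ho P g) := by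
  refine IsUnit.of_mul_eq_one (closedCutIdeal K ho P (-g))
    (eq_of_forall_valSet_eq (K := K) ho fun Q => ?_)
  rw [valSet_mul, valSet_closedCutIdeal ho P Q hfin, valSet_closedCutIdeal ho P Q hfin, valSet_one]
  split_ifs with h
  · subst h
    rw [Ici_inter_add_Ici_inter hg, add_neg_cancel]
  · rw [Ici_inter_add_Ici_inter (zero_mem _), add_zero]

open Classical in
theorem exists_isUnit_valSet_eq_finset (hfin : FiniteCharacter (integralClosure 𝔬 L))
    (g : MaximalSpectrum (integralClosure 𝔬 L) → ℝ) (hg : ∀ P, g P ∈ valGroup K ho P)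
    (s : Finset (MaximalSpectrum (integralClosure 𝔬 L))) :
    ∃ M : FracMon (integralClosure 𝔬 L) L, IsUnit M ∧
      ∀ P, valSet K ho P M = Set.Ici (if P ∈ s then g P else 0) ∩ valGroup K ho P := by
  induction s using Finset.induction_on with
  | empty => exact ⟨1, isUnit_one, fun P => by simp [valSet_one]⟩
  | insert R s hR ih =>
    obtain ⟨M, hM, h⟩ := ih
    refine ⟨closedCutIdeal K ho R (g R) * M, (isUnit_closedCutIdeal ho R hfin (hg R)).mul hM,
      fun P => ?_⟩
    rw [valSet_mul, valSet_closedCutIdeal ho R P hfin, h]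
    by_cases hP : P = R
    · subst hP
      rw [if_pos rfl, if_neg hR, Ici_inter_add_Ici_inter (hg P), add_zero,
        if_pos (Finset.mem_insert_self _ _)]
    · by_cases hPs : P ∈ s
      · rw [if_neg hP, if_pos hPs, Ici_inter_add_Ici_inter (zero_mem _), zero_add,
          if_pos (Finset.mem_insert_of_mem hPs)]
      · rw [if_neg hP, if_neg hPs, Ici_inter_add_Ici_inter (zero_mem _), zero_add,
          if_neg (by simp [hP, hPs])]

/-- Two fractional ideals with the same classes at all places differ by an invertible one. -/
theorem exists_isUnit_mul_eq (hfin : FiniteCharacter (integralClosure 𝔬 L))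
    {I J : FracMon (integralClosure 𝔬 L) L}
    (h : ∀ P, infClass (valGroup K ho P) (valSet K ho P I) =
      infClass (valGroup K ho P) (valSet K ho P J)) :
    ∃ M : FracMon (integralClosure 𝔬 L) L, IsUnit M ∧ M * I = J := by
  classical
  have key := fun P => eq_singleton_add_of_infClass_eq (isCut_valSet (K := K) ho P I)
    (isCut_valSet (K := K) ho P J) (h P)
  have hf := (finite_valSet_ne (K := K) ho hfin I).union (finite_valSet_ne (K := K) ho hfin J)
  -- The prescribed value at each place is the difference of the infima, which `key` puts in the
  -- value group.
  obtain ⟨M, hM, hMv⟩ := exists_isUnit_valSet_eq_finset ho hfin _ (fun P => (key P).1) hf.toFinset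
  refine ⟨M, hM, eq_of_forall_valSet_eq (K := K) ho fun P => ?_⟩
  rw [valSet_mul, hMv]
  -- Off the finite set both value sets are trivial, so the required translation is already 0.
  have e : (if P ∈ hf.toFinset then sInf (valSet K ho P J) - sInf (valSet K ho P I) else 0) =
      sInf (valSet K ho P J) - sInf (valSet K ho P I) := by
    split_ifs with hP
    · rfl
    · rw [hf.mem_toFinset] at hP
      simp only [Set.mem_union, Set.mem_ofPred_eq, not_or, not_not] at hP
      rw [hP.1, hP.2, sub_self]
  rw [e, (isCut_valSet ho P I).Ici_inter_add (key P).1]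
  exact (key P).2.symm

/-- The group is a separate variable because the coefficients of the direct sum use the place `pL
p`, while the value sets are taken at its conjugates. -/
theorem infClass_valSet_mul (I J : FracMon (integralClosure 𝔬 L) L) (G : AddSubgroup ℝ)
    (hG : G = valGroup K ho P) :
    infClass G (valSet K ho P (I * J)) =
      infClass G (valSet K ho P I) + infClass G (valSet K ho P J) := by
  subst hG
  rw [valSet_mul, infClass_add (isCut_valSet ho P I) (isCut_valSet ho P J)]

end Values

/-! ### The Galois action on maximal ideals -/

section GaloisAction

variable {𝔬 K L : Type*} [CommRing 𝔬] [IsDedekindDomain 𝔬] [Field K] [Algebra 𝔬 K]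
  [IsFractionRing 𝔬 K] [Field L] [Algebra K L] [Algebra 𝔬 L] [IsScalarTower 𝔬 K L]
  [IsGalois K L]

theorem galRing_one_apply (x : integralClosure 𝔬 L) : galRing 𝔬 (1 : Gal(L/K)) x = x :=
  Subtype.ext (coe_galRing _ _)

theorem galRing_mul_apply (σ τ : Gal(L/K)) (x : integralClosure 𝔬 L) :
    galRing 𝔬 (σ * τ) x = galRing 𝔬 σ (galRing 𝔬 τ x) :=
  Subtype.ext (by simp [coe_galRing])

theorem galRing_algebraMap (σ : Gal(L/K)) (r : 𝔬) :
    galRing 𝔬 σ (algebraMap 𝔬 (integralClosure 𝔬 L) r) = algebraMap 𝔬 _ r := by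
  apply Subtype.ext
  rw [coe_galRing]
  change σ (algebraMap 𝔬 L r) = algebraMap 𝔬 L r
  rw [IsScalarTower.algebraMap_apply 𝔬 K L, AlgEquiv.commutes]

/-- The maximal ideal `σ(𝔓)`. -/
noncomputable def galMax (σ : Gal(L/K)) (P : MaximalSpectrum (integralClosure 𝔬 L)) :
    MaximalSpectrum (integralClosure 𝔬 L) where
  asIdeal := P.asIdeal.comap (galRing 𝔬 σ⁻¹)
  isMaximal := by
    have := P.isMaximal
    exact Ideal.comap_isMaximal_of_equiv _

theorem mem_galMax {σ : Gal(L/K)} {P : MaximalSpectrum (integralClosure 𝔬 L)}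
    {x : integralClosure 𝔬 L} : x ∈ (galMax σ P).asIdeal ↔ galRing 𝔬 σ⁻¹ x ∈ P.asIdeal :=
  Iff.rfl

theorem galMax_mul (σ τ : Gal(L/K)) (P : MaximalSpectrum (integralClosure 𝔬 L)) :
    galMax (σ * τ) P = galMax σ (galMax τ P) := by
  refine MaximalSpectrum.ext (Ideal.ext fun x => ?_)
  rw [mem_galMax, mem_galMax, mem_galMax, mul_inv_rev, galRing_mul_apply]

theorem galMax_one (P : MaximalSpectrum (integralClosure 𝔬 L)) :
    galMax (1 : Gal(L/K)) P = P := by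
  refine MaximalSpectrum.ext (Ideal.ext fun x => ?_)
  rw [mem_galMax, inv_one, galRing_one_apply]

theorem galMax_inv_galMax (σ : Gal(L/K)) (P : MaximalSpectrum (integralClosure 𝔬 L)) :
    galMax σ⁻¹ (galMax σ P) = P := by
  rw [← galMax_mul, inv_mul_cancel, galMax_one]

theorem galMax_eq_self_iff {σ : Gal(L/K)} {P : MaximalSpectrum (integralClosure 𝔬 L)} :
    galMax σ P = P ↔ σ ∈ decompGroup K P := by
  -- `galMax σ` is a preimage under σ⁻¹, so its stabilizer condition is the one for σ⁻¹.
  rw [← inv_mem_iff]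
  constructor
  · intro h x
    rw [← mem_galMax, h]
  · intro h
    exact MaximalSpectrum.ext (Ideal.ext fun x => h x)

theorem galMax_eq_galMax_iff {σ τ : Gal(L/K)} {P : MaximalSpectrum (integralClosure 𝔬 L)} :
    galMax σ P = galMax τ P ↔
      (σ : Gal(L/K) ⧸ decompGroup K P) = (τ : Gal(L/K) ⧸ decompGroup K P) := by
  rw [QuotientGroup.eq, ← inv_mem_iff, mul_inv_rev, inv_inv, ← galMax_eq_self_iff, galMax_mul]
  constructor
  · intro h
    rw [h, galMax_inv_galMax]
  · intro h
    have := congrArg (galMax τ) h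
    rwa [← galMax_mul, mul_inv_cancel, galMax_one] at this

theorem comap_galMax (σ : Gal(L/K)) (P : MaximalSpectrum (integralClosure 𝔬 L)) :
    (galMax σ P).asIdeal.comap (algebraMap 𝔬 (integralClosure 𝔬 L)) =
      P.asIdeal.comap (algebraMap 𝔬 (integralClosure 𝔬 L)) := by
  ext r
  rw [Ideal.mem_comap, Ideal.mem_comap, mem_galMax, galRing_algebraMap]

variable (K) in
/-- The Galois group acts transitively on the maximal ideals above a given prime. -/
theorem exists_galMax_eq {P Q : MaximalSpectrum (integralClosure 𝔬 L)}
    (h : P.asIdeal.comap (algebraMap 𝔬 (integralClosure 𝔬 L)) =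
      Q.asIdeal.comap (algebraMap 𝔬 (integralClosure 𝔬 L))) :
    ∃ σ : Gal(L/K), galMax σ P = Q := by
  have := isFractionRing_integralClosure 𝔬 K L
  let _ : MulSemiringAction Gal(L/K) (integralClosure 𝔬 L) :=
    IsIntegralClosure.MulSemiringAction 𝔬 K L _
  have hsmul : ∀ (σ : Gal(L/K)) (x : integralClosure 𝔬 L), σ • x = galRing 𝔬 σ x :=
    fun _ _ => rfl
  have : SMulCommClass Gal(L/K) 𝔬 (integralClosure 𝔬 L) := ⟨fun σ r x => by
    rw [hsmul, hsmul, Algebra.smul_def, Algebra.smul_def, map_mul, galRing_algebraMap]⟩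
  -- A Galois-fixed element lies in `K`; being integral over the integrally closed 𝔬, it comes from
  -- 𝔬.
  have : Algebra.IsInvariant 𝔬 (integralClosure 𝔬 L) Gal(L/K) := ⟨fun b hb => by
    obtain ⟨k, hk⟩ := IntermediateField.mem_bot.1 ((InfiniteGalois.mem_bot_iff_fixed (k := K) (b : L)).2
      fun σ => by rw [← coe_galRing, ← hsmul, hb])
    have hint : IsIntegral 𝔬 (algebraMap K L k) := hk ▸ b.2
    rw [isIntegral_algebraMap_iff (algebraMap K L).injective] at hint
    obtain ⟨a, rfl⟩ := IsIntegrallyClosed.algebraMap_eq_of_integral hint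
    exact ⟨a, Subtype.ext (by rw [← hk, ← IsScalarTower.algebraMap_apply]; rfl)⟩⟩
  -- For the discrete topology, continuity of the action means open stabilizers, which holds because
  -- each element is algebraic. This makes the transitivity theorem for profinite groups applicable.
  let _ : TopologicalSpace (integralClosure 𝔬 L) := ⊥
  have : DiscreteTopology (integralClosure 𝔬 L) := ⟨rfl⟩
  have : ContinuousSMul Gal(L/K) (integralClosure 𝔬 L) := by
    refine (continuousSMul_iff_stabilizer_isOpen (M := Gal(L/K))
      (X := integralClosure 𝔬 L)).2 fun x => ?_
    convert stabilizer_isOpen_of_isIntegral (K := K) (x : L) using 1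
    ext σ
    simp only [SetLike.mem_coe, MulAction.mem_stabilizer_iff]
    rw [hsmul, ← Subtype.coe_inj, coe_galRing]
    rfl
  have := P.isMaximal.isPrime
  have := Q.isMaximal.isPrime
  obtain ⟨σ, hσ⟩ := Algebra.IsInvariant.exists_smul_of_under_eq_of_profinite (A := 𝔬)
    (G := Gal(L/K)) P.asIdeal Q.asIdeal h
  refine ⟨σ, MaximalSpectrum.ext (Ideal.ext fun x => ?_)⟩
  rw [mem_galMax, hσ, Ideal.mem_pointwise_smul_iff_inv_smul_mem, hsmul]

/-! ### Conjugate valuations -/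

theorem MemLocAt.galMax {P : MaximalSpectrum (integralClosure 𝔬 L)} {x : L} (h : MemLocAt P x)
    (σ : Gal(L/K)) : MemLocAt (galMax σ P) (σ x) := by
  obtain ⟨a, s, hs, e⟩ := h
  refine ⟨galRing 𝔬 σ a, galRing 𝔬 σ s, ?_, by rw [coe_galRing, coe_galRing, ← map_mul, e]⟩
  rwa [mem_galMax, ← galRing_mul_apply, inv_mul_cancel, galRing_one_apply]

theorem memLocAt_galMax_iff {P : MaximalSpectrum (integralClosure 𝔬 L)} {x : L}
    (σ : Gal(L/K)) : MemLocAt (galMax σ P) (σ x) ↔ MemLocAt P x := by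
  refine ⟨fun h => ?_, fun h => h.galMax σ⟩
  have := h.galMax σ⁻¹
  rwa [galMax_inv_galMax, ← AlgEquiv.mul_apply, inv_mul_cancel, AlgEquiv.one_apply] at this

/-- The action of an automorphism on `Lˣ`. -/
def galUnit (σ : Gal(L/K)) : Lˣ →* Lˣ := Units.map (σ : L →* L)

theorem coe_galUnit (σ : Gal(L/K)) (x : Lˣ) : (galUnit σ x : L) = σ (x : L) := rfl

variable (ho : ¬ IsField 𝔬) (P : MaximalSpectrum (integralClosure 𝔬 L))

/-- The composite is again normalized, as σ fixes `K`, and its valuation ring is the localization at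
`P`; uniqueness of the normalized valuation does the rest. -/
theorem normVal_galMax (σ : Gal(L/K)) :
    (normVal K ho (galMax σ P)).comp (MonoidHom.toAdditive (galUnit σ)) = normVal K ho P := by
  have hv := normVal_spec K ho (galMax σ P)
  refine IsNormalizedValuation.unique ho ⟨fun x y z h => ?_, fun x => ?_, fun q => ?_⟩
    (normVal_spec K ho P)
  · exact hv.min_le_add (galUnit σ x) (galUnit σ y) (galUnit σ z) (by
      rw [coe_galUnit, coe_galUnit, coe_galUnit, ← map_add, h])
  · exact (hv.nonneg_iff (galUnit σ x)).trans (memLocAt_galMax_iff σ)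
  · rw [← hv.map_base]
    refine exists_congr fun k => ?_
    have : galUnit σ (Units.map (algebraMap K L : K →* L) k) =
        Units.map (algebraMap K L : K →* L) k := Units.ext (σ.commutes k)
    exact Eq.congr_left (congrArg (fun u => normVal K ho (galMax σ P) (Additive.ofMul u)) this)

theorem realVal_galMax (σ : Gal(L/K)) (x : Lˣ) :
    realVal K ho (galMax σ P) (galUnit σ x) = realVal K ho P x := by
  unfold realVal
  rw [← normVal_galMax ho P σ]
  rfl

theorem galUnit_galUnit_inv (σ : Gal(L/K)) (x : Lˣ) : galUnit σ (galUnit σ⁻¹ x) = x :=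
  Units.ext (by rw [coe_galUnit, coe_galUnit, ← AlgEquiv.mul_apply, mul_inv_cancel,
    AlgEquiv.one_apply])

theorem valGroup_galMax (σ : Gal(L/K)) : valGroup K ho (galMax σ P) = valGroup K ho P := by
  ext g
  constructor
  · intro hg
    obtain ⟨x, rfl⟩ := exists_realVal_eq ho _ hg
    rw [← galUnit_galUnit_inv σ x, realVal_galMax]
    exact realVal_mem ho P _
  · intro hg
    obtain ⟨x, rfl⟩ := exists_realVal_eq ho _ hg
    rw [← realVal_galMax ho P σ]
    exact realVal_mem ho _ _

/-- The action of an automorphism on fractional ideals. -/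
noncomputable def galFrac (σ : Gal(L/K)) :
    FracMon (integralClosure 𝔬 L) L →* FracMon (integralClosure 𝔬 L) L :=
  FracMon.act (σ : L ≃+* L) (galRing 𝔬 σ) fun r => (coe_galRing σ r).symm

theorem valSet_galMax (σ : Gal(L/K)) (I : FracMon (integralClosure 𝔬 L) L) :
    valSet K ho (galMax σ P) (galFrac σ I) = valSet K ho P I := by
  ext g
  constructor
  · rintro ⟨x, ⟨y, hy, hyx⟩, rfl⟩
    have hyx : σ y = x := hyx
    have hy0 : y ≠ 0 := by
      rintro rfl
      exact x.ne_zero (by rw [← hyx, map_zero])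
    refine ⟨Units.mk0 y hy0, hy, ?_⟩
    rw [← realVal_galMax ho P σ]
    congr 1
    exact Units.ext hyx
  · rintro ⟨x, hx, rfl⟩
    exact ⟨galUnit σ x, ⟨x, hx, rfl⟩, realVal_galMax ho P σ x⟩

end GaloisAction

/-! ### The isomorphism -/

section Main

variable {𝔬 K L : Type*} [CommRing 𝔬] [IsDedekindDomain 𝔬] [Field K] [Algebra 𝔬 K]
  [IsFractionRing 𝔬 K] [Field L] [Algebra K L] [Algebra 𝔬 L] [IsScalarTower 𝔬 K L]
  [IsGalois K L] (ho : ¬ IsField 𝔬)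
  (pL : MaximalSpectrum 𝔬 → MaximalSpectrum (integralClosure 𝔬 L))

variable (K) in
/-- The maximal ideal `τ(𝔭_L)` for a coset `τ D_𝔭`. -/
noncomputable def cosetMax (p : MaximalSpectrum 𝔬) (t : Gal(L/K) ⧸ decompGroup K (pL p)) :
    MaximalSpectrum (integralClosure 𝔬 L) :=
  galMax t.out (pL p)

/-- The choice of representative is harmless because the decomposition group fixes `pL p`. -/
theorem cosetMax_mk (p : MaximalSpectrum 𝔬) (σ : Gal(L/K)) :
    cosetMax K pL p (σ : Gal(L/K) ⧸ decompGroup K (pL p)) = galMax σ (pL p) :=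
  galMax_eq_galMax_iff.2 (QuotientGroup.out_eq' _)

theorem galMax_cosetMax (p : MaximalSpectrum 𝔬) (σ : Gal(L/K))
    (t : Gal(L/K) ⧸ decompGroup K (pL p)) :
    galMax σ (cosetMax K pL p t) = cosetMax K pL p (σ • t) := by
  induction t using QuotientGroup.induction_on with | H τ =>
  rw [cosetMax_mk, ← galMax_mul]
  exact (cosetMax_mk pL p (σ * τ)).symm

theorem valGroup_cosetMax (p : MaximalSpectrum 𝔬) (t : Gal(L/K) ⧸ decompGroup K (pL p)) :
    valGroup K ho (pL p) = valGroup K ho (cosetMax K pL p t) :=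
  (valGroup_galMax ho _ _).symm

variable {pL} in
theorem cosetMax_injective (hpL : ∀ p : MaximalSpectrum 𝔬,
    (pL p).asIdeal.comap (algebraMap 𝔬 (integralClosure 𝔬 L)) = p.asIdeal) :
    Function.Injective fun k : Σ p : MaximalSpectrum 𝔬, Gal(L/K) ⧸ decompGroup K (pL p) =>
      cosetMax K pL k.1 k.2 := by
  rintro ⟨p, t⟩ ⟨q, u⟩ h
  have h : cosetMax K pL p t = cosetMax K pL q u := h
  have hpq : p = q := by
    refine MaximalSpectrum.ext ?_
    rw [← hpL p, ← hpL q, ← comap_galMax t.out (pL p), ← comap_galMax u.out (pL q)]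
    exact congrArg (fun P => P.asIdeal.comap (algebraMap 𝔬 (integralClosure 𝔬 L))) h
  subst hpq
  induction t using QuotientGroup.induction_on with | H σ =>
  induction u using QuotientGroup.induction_on with | H τ =>
  rw [cosetMax_mk, cosetMax_mk, galMax_eq_galMax_iff] at h
  rw [h]

-- This is transitivity of the Galois action. With `cosetMax_injective`, the pairs of a prime and a
-- coset enumerate the maximal ideals of 𝔒 without repetition.
variable {pL} in
theorem exists_cosetMax_eq (hpL : ∀ p : MaximalSpectrum 𝔬,
    (pL p).asIdeal.comap (algebraMap 𝔬 (integralClosure 𝔬 L)) = p.asIdeal)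
    (P : MaximalSpectrum (integralClosure 𝔬 L)) :
    ∃ (p : MaximalSpectrum 𝔬) (t : Gal(L/K) ⧸ decompGroup K (pL p)), cosetMax K pL p t = P := by
  have := P.isMaximal
  let p : MaximalSpectrum 𝔬 := ⟨P.asIdeal.comap (algebraMap 𝔬 (integralClosure 𝔬 L)),
    Ideal.isMaximal_comap_of_isIntegral_of_isMaximal P.asIdeal⟩
  obtain ⟨σ, hσ⟩ := exists_galMax_eq K (P := pL p) (Q := P) (hpL p)
  exact ⟨p, σ, by rw [cosetMax_mk, hσ]⟩

variable (K) in
/-- The direct sum of the local contributions `{0} ⊔ ℝ / v_𝔭(Lˣ)`. -/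
abbrev LocalSum : Type _ :=
  ⨁ p : RamInf K ho pL, ⨁ _ : Gal(L/K) ⧸ decompGroup K (pL p),
    WithZero (ℝ ⧸ valGroup K ho (pL p))

variable {pL} in
theorem exists_localSum (hpL : ∀ p : MaximalSpectrum 𝔬,
    (pL p).asIdeal.comap (algebraMap 𝔬 (integralClosure 𝔬 L)) = p.asIdeal)
    (hfin : FiniteCharacter (integralClosure 𝔬 L)) (I : FracMon (integralClosure 𝔬 L) L) :
    ∃ d : LocalSum K ho pL, ∀ p t,
      d p t = infClass (valGroup K ho (pL p)) (valSet K ho (cosetMax K pL p t) I) := by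
  refine exists_directSum_apply_eq
    (fun (p : RamInf K ho pL) (t : Gal(L/K) ⧸ decompGroup K (pL p)) =>
      infClass (valGroup K ho (pL p)) (valSet K ho (cosetMax K pL p t) I)) ?_
  have hinj : Function.Injective
      fun k : Σ p : RamInf K ho pL, Gal(L/K) ⧸ decompGroup K (pL p) =>
        cosetMax K pL (k.1 : MaximalSpectrum 𝔬) k.2 := by
    rintro ⟨p, t⟩ ⟨q, u⟩ h
    have := cosetMax_injective hpL (a₁ := ⟨p, t⟩) (a₂ := ⟨q, u⟩) h
    obtain ⟨p, hp⟩ := p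
    obtain ⟨q, hq⟩ := q
    cases this
    rfl
  -- A non-zero class forces a non-trivial value set, and injectivity of the enumeration pulls the
  -- finiteness back to the indices.
  refine ((finite_valSet_ne (K := K) ho hfin I).preimage hinj.injOn).subset ?_
  intro k hk hc
  refine hk ?_
  rw [hc]
  exact infClass_of_isLeast (isLeast_Ici_inter (zero_mem _))

variable (K) {pL} in
/-- The class of a fractional ideal in the direct sum of the local contributions. -/
noncomputable def localClass (hpL : ∀ p : MaximalSpectrum 𝔬,
    (pL p).asIdeal.comap (algebraMap 𝔬 (integralClosure 𝔬 L)) = p.asIdeal)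
    (hfin : FiniteCharacter (integralClosure 𝔬 L)) :
    FracMon (integralClosure 𝔬 L) L →* Multiplicative (LocalSum K ho pL) :=
  have hd := fun I => (exists_localSum ho hpL hfin I).choose_spec
  have hext : ∀ x y : LocalSum K ho pL, (∀ p t, x p t = y p t) → x = y :=
    fun x y h => DFinsupp.ext fun p => DFinsupp.ext fun t => h p t
  { toFun := fun I => .ofAdd (exists_localSum ho hpL hfin I).choose
    map_one' := by
      refine hext _ _ fun p t => (hd 1 p t).trans ?_
      rw [valSet_one]
      exact infClass_of_isLeast (isLeast_Ici_inter (zero_mem _))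
    map_mul' := by
      refine fun I J => hext _ _ fun p t => (hd _ p t).trans ?_
      rw [infClass_valSet_mul ho _ I J _ (valGroup_cosetMax ho pL p t), ← hd I, ← hd J]
      rfl }

section

variable {pL} {hpL : ∀ p : MaximalSpectrum 𝔬,
    (pL p).asIdeal.comap (algebraMap 𝔬 (integralClosure 𝔬 L)) = p.asIdeal}
  {hfin : FiniteCharacter (integralClosure 𝔬 L)}

theorem localClass_apply (I : FracMon (integralClosure 𝔬 L) L) (p : RamInf K ho pL)
    (t : Gal(L/K) ⧸ decompGroup K (pL p)) :
    (localClass K ho hpL hfin I).toAdd p t =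
      infClass (valGroup K ho (pL p)) (valSet K ho (cosetMax K pL p t) I) :=
  (exists_localSum ho hpL hfin I).choose_spec p t

theorem LocalSum.ext {x y : Multiplicative (LocalSum K ho pL)}
    (h : ∀ p t, x.toAdd p t = y.toAdd p t) : x = y :=
  congrArg Multiplicative.ofAdd (DFinsupp.ext fun p => DFinsupp.ext fun t => h p t)

theorem localClass_eq_one_of_mem_PrincMon {I : FracMon (integralClosure 𝔬 L) L}
    (hI : I ∈ PrincMon (integralClosure 𝔬 L) L) : localClass K ho hpL hfin I = 1 := by
  refine LocalSum.ext ho fun p t => ?_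
  rw [localClass_apply]
  obtain ⟨g, hg⟩ := isLeast_valSet_of_mem_PrincMon (K := K) ho (cosetMax K pL p t) hI
  exact infClass_of_isLeast hg

/-- In {0} ⊔ A a sum is the adjoined 0 only if both terms are, so the target has no units besides
the neutral element. -/
theorem localClass_eq_one_of_isUnit {I : FracMon (integralClosure 𝔬 L) L}
    (hI : IsUnit I) : localClass K ho hpL hfin I = 1 := by
  refine LocalSum.ext ho fun p t => ?_
  obtain ⟨J, hJ⟩ := hI.exists_right_inv
  have h := congrArg (fun x : Multiplicative (LocalSum K ho pL) => x.toAdd p t)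
    ((map_mul (localClass K ho hpL hfin) I J).symm.trans (by rw [hJ, map_one]))
  have h : (localClass K ho hpL hfin I).toAdd p t + (localClass K ho hpL hfin J).toAdd p t = 0 := h
  change _ = 0
  generalize (localClass K ho hpL hfin I).toAdd p t = a at h ⊢
  generalize (localClass K ho hpL hfin J).toAdd p t = b at h
  cases a with
  | zero => rfl
  | coe a =>
    cases b with
    | zero => rwa [add_zero] at h
    | coe b => exact absurd h WithZero.coe_ne_zero

/-- A dense closed value group would be all of ℝ, but values are rational and √2 is not. -/
theorem not_dense_of_notMem_RamInf {p : MaximalSpectrum 𝔬} (hp : p ∉ RamInf K ho pL) :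
    ¬ Dense (valGroup K ho (pL p) : Set ℝ) := by
  intro h
  have h1 : (valGroup K ho (pL p) : Set ℝ) = closure (valGroup K ho (pL p) : Set ℝ) :=
    not_not.1 hp
  have h2 : √2 ∈ (valGroup K ho (pL p) : Set ℝ) := by
    rw [h1, h.closure_eq]
    trivial
  obtain ⟨x, hx⟩ := h2
  exact irrational_sqrt_two ⟨_, hx⟩

/-- At places over primes outside `RamInf` every cut has a minimum, so the classes omitted from the
direct sum agree automatically. -/
theorem exists_isUnit_mul_eq_of_localClass_eq {I J : FracMon (integralClosure 𝔬 L) L}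
    (h : localClass K ho hpL hfin I = localClass K ho hpL hfin J) :
    ∃ M : FracMon (integralClosure 𝔬 L) L, IsUnit M ∧ M * I = J := by
  refine exists_isUnit_mul_eq (K := K) ho hfin fun P => ?_
  obtain ⟨p, t, rfl⟩ := exists_cosetMax_eq (K := K) hpL P
  by_cases hp : p ∈ RamInf K ho pL
  · rw [← valGroup_cosetMax, ← localClass_apply ho (hpL := hpL) (hfin := hfin) I ⟨p, hp⟩,
      ← localClass_apply ho (hpL := hpL) (hfin := hfin) J ⟨p, hp⟩, h]
  · have hd := not_dense_of_notMem_RamInf ho hp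
    rw [valGroup_cosetMax ho pL p t] at hd
    rw [infClass_of_mem ((isCut_valSet ho _ I).sInf_mem hd),
      infClass_of_mem ((isCut_valSet ho _ J).sInf_mem hd)]

theorem localClass_surjective : Function.Surjective (localClass K ho hpL hfin) := by
  classical
  intro x
  refine directSum_mem_of_forall
    (AddMonoidHom.mrange (MonoidHom.toAdditiveLeft (localClass K ho hpL hfin))) ?_ x.toAdd
  intro p t z
  induction z with
  | zero => rw [map_zero, map_zero]; exact zero_mem _
  | coe z =>
    induction z using QuotientAddGroup.induction_on with | H r =>
    -- The open ray above `r` at a single place hits the generator given by `r` there; all other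
    -- classes are trivial.
    let I := cutIdeal K ho (cosetMax K pL p t) (Set.Ioi r) (isUpperSet_Ioi r) bddBelow_Ioi
      Set.nonempty_Ioi
    refine ⟨Additive.ofMul I, (directSum_of_of_apply
      (α := fun p : RamInf K ho pL => Gal(L/K) ⧸ decompGroup K (pL p))
      (δ := fun p : RamInf K ho pL => WithZero (ℝ ⧸ valGroup K ho (pL p))) p t _
      (localClass K ho hpL hfin I).toAdd ?_ ?_).symm⟩
    · refine (localClass_apply ho I p t).trans ?_
      rw [valSet_cutIdeal ho _ hfin, ← valGroup_cosetMax]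
      exact infClass_Ioi_inter (dense_of_ne_closure p.2) r
    · intro q u hne
      refine (localClass_apply ho I q u).trans ?_
      rw [valSet_cutIdeal_of_ne ho fun h => hne ?_]
      · exact infClass_of_isLeast (isLeast_Ici_inter (zero_mem _))
      · obtain ⟨p, hp⟩ := p
        obtain ⟨q, hq⟩ := q
        cases cosetMax_injective hpL (a₁ := ⟨p, t⟩) (a₂ := ⟨q, u⟩) h
        rfl

theorem localClass_galFrac (σ : Gal(L/K)) (I : FracMon (integralClosure 𝔬 L) L)
    (p : RamInf K ho pL) (t : Gal(L/K) ⧸ decompGroup K (pL p)) :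
    (localClass K ho hpL hfin (galFrac σ I)).toAdd p t =
      (localClass K ho hpL hfin I).toAdd p (σ⁻¹ • t) := by
  rw [localClass_apply, localClass_apply, ← galMax_cosetMax, ← valSet_galMax ho _ σ I,
    ← galMax_mul, mul_inv_cancel, galMax_one]

end

end Main

theorem corollary2p12 {𝔬 K L : Type*} [CommRing 𝔬] [IsDedekindDomain 𝔬] [Field K] [Algebra 𝔬 K]
    [IsFractionRing 𝔬 K] [Field L] [Algebra K L] [Algebra 𝔬 L] [IsScalarTower 𝔬 K L]
    [IsGalois K L] (ho : ¬ IsField 𝔬)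
    (pL : MaximalSpectrum 𝔬 → MaximalSpectrum (integralClosure 𝔬 L))
    (hpL : ∀ p : MaximalSpectrum 𝔬,
      (pL p).asIdeal.comap (algebraMap 𝔬 (integralClosure 𝔬 L)) = p.asIdeal)
    (hfin : FiniteCharacter (integralClosure 𝔬 L)) :
    ∃ e : RegClModPic (integralClosure 𝔬 L) L ≃*
        Multiplicative (⨁ p : RamInf K ho pL, ⨁ _ : Gal(L/K) ⧸ decompGroup K (pL p),
          WithZero (ℝ ⧸ valGroup K ho (pL p))),
      ∀ (σ : Gal(L/K)) (c : RegClModPic (integralClosure 𝔬 L) L) (p : RamInf K ho pL)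
        (t : Gal(L/K) ⧸ decompGroup K (pL p)),
        (e (galAct σ c)).toAdd p t = (e c).toAdd p (σ⁻¹ • t) := by
  obtain ⟨e, he⟩ := exists_regQuot_mulEquiv (PrincMon (integralClosure 𝔬 L) L)
    (localClass K ho hpL hfin) (localClass_surjective ho)
    (fun _ h => localClass_eq_one_of_mem_PrincMon ho h)
    (fun _ h => localClass_eq_one_of_isUnit ho h)
    (fun I J h => by
      obtain ⟨M, hM, hMI⟩ := exists_isUnit_mul_eq_of_localClass_eq ho h
      exact ⟨M, hM, 1, Submonoid.one_mem _, by rw [hMI, one_mul]⟩)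
    (fun x => directSum_mem_Reg (fun _ y => directSum_mem_Reg (fun _ z => withZero_mem_Reg z) y)
      x.toAdd)
  refine ⟨e, fun σ c p t => ?_⟩
  induction c using Con.induction_on with | _ c =>
  obtain ⟨c, hc⟩ := c
  induction c using Con.induction_on with | _ I =>
  have h1 := he I hc
  -- The class of `galFrac σ I` is by definition `galAct σ` of the class of `I`, so equivariance can
  -- be checked on ideals.
  have h2 := he (galFrac σ I) (Reg_map_mem (IdealCl.act (σ : L ≃+* L) (galRing 𝔬 σ)
    fun r => (coe_galRing σ r).symm) hc)
  have h3 := localClass_galFrac (hpL := hpL) (hfin := hfin) ho σ I p t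
  exact ((DFunLike.congr_fun (DFunLike.congr_fun (congrArg Multiplicative.toAdd h2) p) t).trans
    h3).trans
    (DFunLike.congr_fun (DFunLike.congr_fun (congrArg Multiplicative.toAdd h1) p) (σ⁻¹ • t)).symm
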